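/- Let $p$ be an odd prime and let $m$ be an integer whose class modulo $p$ has multiplicative order $p-1$. Let $G=G(p,p-1)=\langle x,y\mid x^p=1,\ y^{p-1}=1,\ yx=x^my\rangle$ and $\Lambda=\mathbb{Z}[G]$; all modules are right $\Lambda$-modules. Let $C_{p-1}$ be the cyclic group of order $p-1$ generated by $y$, let $\mathbb{Z}[C_{p-1}]$ be a $\Lambda$-module through the projection $G\to C_{p-1}$, $x\mapsto 1$, $y\mapsto y$, and let $I(C_{p-1})$ be the kernel of the augmentation $\mathbb{Z}[C_{p-1}]\to\mathbb{Z}$. Let $[y-1)=(y-1)\Lambda$ be the right ideal of $\Lambda$ generated by $y-1$. Let $\mathcal{T}_{p-1}=\{(a_{i,j})\in M_{p-1}(\mathbb{Z})\mid a_{i,j}\in p\mathbb{Z}\text{ if } i>j\}$. Let $\zeta$ be a primitive $p$-th root of unity and $\pi=\zeta-1$. In the $\mathbb{Z}$-basis $\pi^{p-2},\dots,\pi,1$ of $\mathbb{Z}[\zeta]$, the matrix $X$ of multiplication by $\zeta$ and the matrix $Y$ of the ring automorphism $\zeta\mapsto\zeta^m$ (acting on columns) lie in $\mathcal{T}_{p-1}$,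 and $x\mapsto X$, $y\mapsto Y$ defines a ring homomorphism $\Lambda\to\mathcal{T}_{p-1}$. For $1\le k\le p-1$ let $R(k)$ be the $k$-th row of $\mathcal{T}_{p-1}$, i.e. the row vectors $(v_1,\dots,v_{p-1})\in\mathbb{Z}^{p-1}$ with $p\mid v_j$ for $j<k$, on which $\Lambda$ acts by right multiplication through this homomorphism, and let $R(\hat 1)=\bigoplus_{i=2}^{p-1}R(i)$. The projection $\Lambda\to\mathbb{Z}[C_{p-1}]$ restricts to a surjective $\Lambda$-homomorphism $[y-1)\to I(C_{p-1})$, and there is an injective $\Lambda$-homomorphism $\iota:R(\hat 1)\to[y-1)$ whose image is the kernel of this surjection. For every such $\iota$, let $$\mathcal{E}=(0\to R(2)\oplus R(\hat 1)\xrightarrow{\ \mathrm{id}\oplus\iota\ }R(2)\oplus[y-1)\to I(C_{p-1})\to 0)$$ be the resulting short exact sequence, in which the second map is zero on $R(2)$ and the canonical map on $[y-1)$. Then every element of $\mathrm{Ext}^1_\Lambda(I(C_{p-1}),R(2)\oplus R(\hat 1))$ can be written uniquely as the push-out $\alpha_*(\mathcal{E})$, where $\alpha\in\mathrm{End}_\Lambda(R(2)\oplus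 R(\hat 1))$ is given, with respect to the decomposition $R(2)\oplus R(\hat 1)=R(2)\oplus R(2)\oplus R(3)\oplus\dots\oplus R(p-1)$ and acting on columns of components, by an integer matrix $(a_{i,j})_{1\le i,j\le p-1}$ of the form $$\alpha=\begin{pmatrix}0&a_{1,2}\\0&a_{2,2}\end{pmatrix}\oplus\mathrm{diag}(a_{3,3},a_{4,4},\dots,a_{p-1,p-1}),$$ that is, $a_{i,j}=0$ unless $(i,j)=(1,2)$ or $i=j\ge 2$, and with $0\le a_{i,j}\le p-1$ for all $i,j$. -/

import Mathlib

open CategoryTheory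

namespace Metacyclic

noncomputable section

/-! ### The group `G(p, p-1)`, the cyclic group `C_{p-1}` and their integral group rings -/

/-- The relators of `⟨x, y | x ^ p = 1, y ^ (p - 1) = 1, y x = x ^ m y⟩`; here `x` is the generator
`0`, `y` is the generator `1`, and `m` is the representative in `{1, …, p - 1}` of the unit `u`
modulo `p`. -/
def relators (p : ℕ) (u : (ZMod p)ˣ) : Set (FreeGroup (Fin 2)) :=
  {FreeGroup.of 0 ^ p, FreeGroup.of 1 ^ (p - 1),
    (FreeGroup.of 1 * FreeGroup.of 0) *
      (FreeGroup.of 0 ^ (u : ZMod p).val * FreeGroup.of 1)⁻¹}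

/-- The metacyclic group `⟨x, y | x ^ p = 1, y ^ (p - 1) = 1, y x = x ^ m y⟩`. -/
abbrev G (p : ℕ) (u : (ZMod p)ˣ) : Type := PresentedGroup (relators p u)

/-- The generator `x`. -/
def gx (p : ℕ) (u : (ZMod p)ˣ) : G p u := PresentedGroup.of 0

/-- The generator `y`. -/
def gy (p : ℕ) (u : (ZMod p)ˣ) : G p u := PresentedGroup.of 1

/-- The integral group ring `Λ = ℤ[G(p, p - 1)]`. Right `Λ`-modules are modules over `Λᵐᵒᵖ`. -/
abbrev Lam (p : ℕ) (u : (ZMod p)ˣ) : Type := MonoidAlgebra ℤ (G p u)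

/-- The cyclic group `C_{p-1}`, written multiplicatively. -/
abbrev C (p : ℕ) : Type := Multiplicative (ZMod (p - 1))

/-- The generator of `C_{p-1}`. -/
def cy (p : ℕ) : C p := Multiplicative.ofAdd 1

lemma cy_pow (p : ℕ) : cy p ^ (p - 1) = 1 := by
  rw [cy, ← ofAdd_nsmul]
  simp

/-- The projection `G(p, p - 1) → C_{p-1}`, `x ↦ 1`, `y ↦ y`. -/
def toC (p : ℕ) (u : (ZMod p)ˣ) : G p u →* C p :=
  PresentedGroup.toGroup (f := ![1, cy p]) (by
    intro r hr
    rcases hr with rfl | rfl | rfl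
    · simp
    · simp [cy_pow]
    · simp)

/-- The ring homomorphism `Λ → ℤ[C_{p-1}]` induced by the projection. -/
def toZC (p : ℕ) (u : (ZMod p)ˣ) : Lam p u →+* MonoidAlgebra ℤ (C p) :=
  MonoidAlgebra.mapDomainRingHom ℤ (toC p u)

/-- `ℤ[C_{p-1}]` as a right `Λ`-module, through the projection. -/
instance zcModule (p : ℕ) (u : (ZMod p)ˣ) : Module (Lam p u)ᵐᵒᵖ (MonoidAlgebra ℤ (C p)) :=
  Module.compHom (MonoidAlgebra ℤ (C p)) (toZC p u).op

lemma zc_smul_def (p : ℕ) (u : (ZMod p)ˣ) (a : (Lam p u)ᵐᵒᵖ) (b : MonoidAlgebra ℤ (C p)) :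
    a • b = b * toZC p u a.unop := rfl

/-- The augmentation `ε : ℤ[C_{p-1}] → ℤ`. -/
def aug (p : ℕ) : MonoidAlgebra ℤ (C p) →+* ℤ := (MonoidAlgebra.lift ℤ ℤ (C p) 1).toRingHom

/-- `I(C_{p-1})`, the kernel of the augmentation, as a right `Λ`-module. -/
def augIdeal (p : ℕ) (u : (ZMod p)ˣ) : Submodule (Lam p u)ᵐᵒᵖ (MonoidAlgebra ℤ (C p)) where
  carrier := {b | aug p b = 0}
  zero_mem' := map_zero _
  add_mem' := by
    intro a b ha hb
    simp_all
  smul_mem' := by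
    intro c b hb
    simp_all [zc_smul_def]

/-- The right ideal `[y - 1) = (y - 1)Λ`. -/
def yIdeal (p : ℕ) (u : (ZMod p)ˣ) : Submodule (Lam p u)ᵐᵒᵖ (Lam p u) :=
  Submodule.span (Lam p u)ᵐᵒᵖ {MonoidAlgebra.of ℤ (G p u) (gy p u) - 1}

/-- `Λ → ℤ[C_{p-1}]` as a homomorphism of right `Λ`-modules. -/
def toZCLin (p : ℕ) (u : (ZMod p)ˣ) : Lam p u →ₗ[(Lam p u)ᵐᵒᵖ] MonoidAlgebra ℤ (C p) where
  toFun := toZC p u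
  map_add' := map_add _
  map_smul' := by
    intro a b
    simp [zc_smul_def, MulOpposite.smul_eq_mul_unop]

lemma toZC_gy (p : ℕ) (u : (ZMod p)ˣ) :
    toZC p u (MonoidAlgebra.of ℤ (G p u) (gy p u) - 1) =
      MonoidAlgebra.of ℤ (C p) (cy p) - 1 := by
  rw [map_sub, map_one]
  congr 1
  simp [toZC, toC, gy, MonoidAlgebra.of_apply]

lemma mem_yIdeal (p : ℕ) (u : (ZMod p)ˣ) (a : Lam p u) :
    a ∈ yIdeal p u ↔ ∃ b : Lam p u, (MonoidAlgebra.of ℤ (G p u) (gy p u) - 1) * b = a := by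
  rw [yIdeal, Submodule.mem_span_singleton]
  constructor
  · rintro ⟨b, rfl⟩
    exact ⟨b.unop, rfl⟩
  · rintro ⟨b, rfl⟩
    exact ⟨MulOpposite.op b, rfl⟩

lemma aug_of (p : ℕ) (c : C p) : aug p (MonoidAlgebra.of ℤ (C p) c) = 1 := by
  simp [aug, MonoidAlgebra.of_apply]

lemma toZCLin_mem (p : ℕ) (u : (ZMod p)ˣ) (a : yIdeal p u) :
    (toZCLin p u).domRestrict (yIdeal p u) a ∈ augIdeal p u := by
  obtain ⟨b, hb⟩ := (mem_yIdeal p u a).1 a.2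
  change aug p (toZC p u a) = 0
  rw [← hb, map_mul, toZC_gy, map_mul, map_sub, aug_of, map_one, sub_self, zero_mul]

/-- The canonical map `[y - 1) → I(C_{p-1})`: the restriction of the projection
`Λ → ℤ[C_{p-1}]`. -/
def yToAug (p : ℕ) (u : (ZMod p)ˣ) : yIdeal p u →ₗ[(Lam p u)ᵐᵒᵖ] augIdeal p u :=
  ((toZCLin p u).domRestrict (yIdeal p u)).codRestrict (augIdeal p u) (toZCLin_mem p u)

lemma cy_generates (p : ℕ) [Fact p.Prime] (c : C p) : ∃ k : ℕ, c = cy p ^ k := by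
  have : NeZero (p - 1) := ⟨by have := (Fact.out : p.Prime).two_le; omega⟩
  refine ⟨(Multiplicative.toAdd c).val, ?_⟩
  rw [cy, ← ofAdd_nsmul]
  simp

lemma toC_surjective (p : ℕ) (u : (ZMod p)ˣ) [Fact p.Prime] : Function.Surjective (toC p u) := by
  intro c
  obtain ⟨k, rfl⟩ := cy_generates p c
  exact ⟨gy p u ^ k, by simp [toC, gy]⟩

lemma exists_mul_of_aug (p : ℕ) [Fact p.Prime] (a : MonoidAlgebra ℤ (C p)) :
    ∃ b, a = (MonoidAlgebra.of ℤ (C p) (cy p) - 1) * b + algebraMap ℤ _ (aug p a) := by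
  induction a using MonoidAlgebra.induction_on with
  | of c =>
    obtain ⟨k, rfl⟩ := cy_generates p c
    obtain ⟨d, hd⟩ := sub_one_dvd_pow_sub_one (MonoidAlgebra.of ℤ (C p) (cy p)) k
    refine ⟨d, ?_⟩
    rw [← hd, aug_of, map_pow, map_one, sub_add_cancel]
  | add a b ha hb =>
    obtain ⟨a', ha⟩ := ha
    obtain ⟨b', hb⟩ := hb
    refine ⟨a' + b', ?_⟩
    rw [map_add, map_add]
    nth_rewrite 1 [ha, hb]
    ring
  | smul r a ha =>
    obtain ⟨a', ha⟩ := ha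
    refine ⟨r • a', ?_⟩
    nth_rewrite 1 [ha]
    simp only [zsmul_eq_mul, map_mul, map_intCast]
    ring

lemma toZC_surjective (p : ℕ) (u : (ZMod p)ˣ) [Fact p.Prime] : Function.Surjective (toZC p u) := by
  intro a
  induction a using MonoidAlgebra.induction_on with
  | of c =>
    obtain ⟨g, rfl⟩ := toC_surjective p u c
    exact ⟨MonoidAlgebra.of ℤ (G p u) g, by simp [toZC, MonoidAlgebra.of_apply]⟩
  | add a b ha hb =>
    obtain ⟨a, rfl⟩ := ha
    obtain ⟨b, rfl⟩ := hb
    exact ⟨a + b, map_add _ _ _⟩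
  | smul r a ha =>
    obtain ⟨a, rfl⟩ := ha
    exact ⟨r • a, map_zsmul _ _ _⟩

lemma yToAug_surjective (p : ℕ) (u : (ZMod p)ˣ) [Fact p.Prime] :
    Function.Surjective (yToAug p u) := by
  rintro ⟨a, ha⟩
  obtain ⟨b, hb⟩ := exists_mul_of_aug p a
  rw [show aug p a = 0 from ha, map_zero, add_zero] at hb
  obtain ⟨c, rfl⟩ := toZC_surjective p u b
  refine ⟨⟨_, (mem_yIdeal p u _).2 ⟨c, rfl⟩⟩, Subtype.ext ?_⟩
  change toZC p u ((MonoidAlgebra.of ℤ (G p u) (gy p u) - 1) * c) = a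
  rw [map_mul, toZC_gy, hb]

/-! ### The ring `𝒯_{p-1}(ℤ, p)` and its rows -/

/-- The indices `1, …, p - 1`. -/
abbrev Idx (p : ℕ) : Type := ↥(Finset.Icc 1 (p - 1))

/-- `𝒯_{p-1}(ℤ, p)`: integral matrices whose entries below the diagonal are divisible by `p`. -/
def Tri (p : ℕ) : Subring (Matrix (Idx p) (Idx p) ℤ) where
  carrier := {A | ∀ i j, j < i → (p : ℤ) ∣ A i j}
  zero_mem' := by
    intro i j _
    simp
  one_mem' := by
    intro i j h
    simp [Matrix.one_apply_ne h.ne']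
  add_mem' := by
    intro A B hA hB i j h
    exact dvd_add (hA i j h) (hB i j h)
  neg_mem' := by
    intro A hA i j h
    exact (dvd_neg (α := ℤ)).2 (hA i j h)
  mul_mem' := by
    intro A B hA hB i j h
    rw [Matrix.mul_apply]
    refine Finset.dvd_sum fun k _ => ?_
    rcases lt_or_ge k i with hk | hk
    · exact Dvd.dvd.mul_right (hA i k hk) _
    · exact Dvd.dvd.mul_left (hB k j (h.trans_le hk)) _

/-- The `k`-th row `R(k)` of `𝒯_{p-1}(ℤ, p)`: integral row vectors whose entries in the columns
`j < k` are divisible by `p`. -/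
def Row (p k : ℕ) : AddSubgroup (Idx p → ℤ) where
  carrier := {v | ∀ j : Idx p, (j : ℕ) < k → (p : ℤ) ∣ v j}
  zero_mem' := by
    intro j _
    simp
  add_mem' := by
    intro v w hv hw j h
    exact dvd_add (hv j h) (hw j h)
  neg_mem' := by
    intro v hv j h
    exact (dvd_neg (α := ℤ)).2 (hv j h)

lemma vecMul_mem (p k : ℕ) {v : Idx p → ℤ} (hv : v ∈ Row p k) {A : Matrix (Idx p) (Idx p) ℤ}
    (hA : A ∈ Tri p) : Matrix.vecMul v A ∈ Row p k := by
  intro j h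
  change (p : ℤ) ∣ ∑ i, v i * A i j
  refine Finset.dvd_sum fun i _ => ?_
  rcases lt_or_ge j i with hi | hi
  · exact Dvd.dvd.mul_left (hA i j hi) _
  · exact Dvd.dvd.mul_right (hv i (lt_of_le_of_lt hi h)) _

/-- `R(k)` is a right module over `𝒯_{p-1}(ℤ, p)` by multiplication of row vectors by matrices. -/
instance rowModule (p k : ℕ) : Module (Tri p)ᵐᵒᵖ (Row p k) where
  smul A v := ⟨Matrix.vecMul v.1 A.unop.1, vecMul_mem p k v.2 A.unop.2⟩
  one_smul v := Subtype.ext (Matrix.vecMul_one v.1)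
  mul_smul A B v := Subtype.ext (Matrix.vecMul_vecMul v.1 B.unop.1 A.unop.1).symm
  smul_zero A := Subtype.ext (Matrix.zero_vecMul A.unop.1)
  smul_add A v w := Subtype.ext (Matrix.add_vecMul A.unop.1 v.1 w.1)
  add_smul A B v := Subtype.ext (Matrix.vecMul_add A.unop.1 B.unop.1 v.1)
  zero_smul v := Subtype.ext (Matrix.vecMul_zero v.1)

/-! ### The homomorphism `Λ → 𝒯_{p-1}(ℤ, p)`

The group `G(p, p - 1)` acts on `ℤ[ζ]`, `ζ` a primitive `p`-th root of unity: `x` is multiplication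
by `ζ`, `y` is the automorphism `ζ ↦ ζ ^ m`. In the basis `π ^ (p - 2), …, π, 1` with `π = ζ - 1`,
the matrices of `x` and `y` lie in `𝒯_{p-1}(ℤ, p)`. -/

/-- The minimal polynomial of `π = ζ - 1`. -/
def piPoly (p : ℕ) : Polynomial ℤ := (Polynomial.cyclotomic p ℤ).comp (Polynomial.X + 1)

/-- `ℤ[ζ] = ℤ[π]`. -/
abbrev Zeta (p : ℕ) : Type := AdjoinRoot (piPoly p)

/-- `π = ζ - 1`. -/
def pi' (p : ℕ) : Zeta p := AdjoinRoot.root (piPoly p)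

/-- The primitive `p`-th root of unity `ζ = 1 + π`. -/
def zeta (p : ℕ) : Zeta p := pi' p + 1

lemma piPoly_monic (p : ℕ) : (piPoly p).Monic := by
  rw [piPoly, show (Polynomial.X + 1 : Polynomial ℤ) = Polynomial.X + Polynomial.C 1 by simp]
  exact (Polynomial.cyclotomic.monic p ℤ).comp_X_add_C 1

lemma piPoly_natDegree (p : ℕ) [hp : Fact p.Prime] : (piPoly p).natDegree = p - 1 := by
  rw [piPoly, show (Polynomial.X + 1 : Polynomial ℤ) = Polynomial.X + Polynomial.C 1 by simp,
    Polynomial.natDegree_comp, Polynomial.natDegree_X_add_C, mul_one,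
    Polynomial.natDegree_cyclotomic, Nat.totient_prime hp.out]

lemma eval₂_piPoly {S : Type*} [CommRing S] (f : ℤ →+* S) (p : ℕ) [Fact p.Prime] (z : S) :
    (piPoly p).eval₂ f z = ∑ i ∈ Finset.range p, (z + 1) ^ i := by
  rw [piPoly, Polynomial.eval₂_comp, Polynomial.cyclotomic_prime, Polynomial.eval₂_finsetSum]
  simp

lemma sum_zeta (p : ℕ) [Fact p.Prime] : ∑ i ∈ Finset.range p, zeta p ^ i = 0 := by
  rw [zeta, ← eval₂_piPoly (AdjoinRoot.of (piPoly p)), pi', AdjoinRoot.eval₂_root]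

lemma zeta_pow (p : ℕ) [Fact p.Prime] : zeta p ^ p = 1 := by
  have h := geom_sum_mul (zeta p) p
  rw [sum_zeta, zero_mul] at h
  exact (sub_eq_zero.1 h.symm)

lemma zeta_pow_mod (p : ℕ) [Fact p.Prime] (k : ℕ) : zeta p ^ (k % p) = zeta p ^ k := by
  conv_rhs => rw [← Nat.mod_add_div k p, pow_add, pow_mul, zeta_pow, one_pow, mul_one]

lemma sum_zeta_pow (p : ℕ) [Fact p.Prime] (u : (ZMod p)ˣ) :
    ∑ i ∈ Finset.range p, (zeta p ^ (u : ZMod p).val) ^ i = 0 := by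
  have key : ∀ f : ℕ → Zeta p, ∑ i ∈ Finset.range p, f i = ∑ a : ZMod p, f a.val := by
    intro f
    refine Finset.sum_bij' (fun i _ => (i : ZMod p)) (fun a _ => a.val) ?_ ?_ ?_ ?_ ?_
    · intro i _
      exact Finset.mem_univ _
    · intro a _
      exact Finset.mem_range.2 a.val_lt
    · intro i hi
      exact ZMod.val_cast_of_lt (Finset.mem_range.1 hi)
    · intro a _
      exact ZMod.natCast_zmod_val a
    · intro i hi
      rw [ZMod.val_cast_of_lt (Finset.mem_range.1 hi)]
  rw [← sum_zeta p, key, key]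
  refine Fintype.sum_equiv (Units.mulLeft u) _ _ fun a => ?_
  rw [Units.mulLeft_apply, ZMod.val_mul, zeta_pow_mod, pow_mul]

/-- The automorphism of `ℤ[ζ]` with `ζ ↦ ζ ^ m`. -/
def gal (p : ℕ) [Fact p.Prime] (u : (ZMod p)ˣ) : Zeta p →ₐ[ℤ] Zeta p :=
  AdjoinRoot.liftAlgHom (piPoly p) (Algebra.ofId ℤ (Zeta p)) (zeta p ^ (u : ZMod p).val - 1) (by
    rw [eval₂_piPoly, sub_add_cancel, sum_zeta_pow])

lemma gal_pi (p : ℕ) [Fact p.Prime] (u : (ZMod p)ˣ) :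
    gal p u (pi' p) = zeta p ^ (u : ZMod p).val - 1 := by
  exact AdjoinRoot.liftAlgHom_root _ _ _ _

lemma gal_zeta (p : ℕ) [Fact p.Prime] (u : (ZMod p)ˣ) :
    gal p u (zeta p) = zeta p ^ (u : ZMod p).val := by
  rw [zeta, map_add, gal_pi, map_one, ← zeta, sub_add_cancel]

lemma gal_mul (p : ℕ) [Fact p.Prime] (u v : (ZMod p)ˣ) (a : Zeta p) :
    gal p (u * v) a = gal p u (gal p v a) := by
  have h : gal p (u * v) = (gal p u).comp (gal p v) := by
    apply AdjoinRoot.algHom_ext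
    change gal p (u * v) (pi' p) = gal p u (gal p v (pi' p))
    rw [gal_pi, gal_pi, map_sub, map_pow, gal_zeta, map_one, ← pow_mul, Units.val_mul,
      ZMod.val_mul, zeta_pow_mod]
  rw [h, AlgHom.comp_apply]

lemma gal_one (p : ℕ) [hp : Fact p.Prime] (a : Zeta p) : gal p 1 a = a := by
  have h : gal p 1 = AlgHom.id ℤ (Zeta p) := by
    apply AdjoinRoot.algHom_ext
    change gal p 1 (pi' p) = pi' p
    have : Fact (1 < p) := ⟨hp.out.one_lt⟩
    rw [gal_pi, Units.val_one, ZMod.val_one, pow_one, zeta, add_sub_cancel_right]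
  rw [h, AlgHom.id_apply]

/-- The order-reversing bijection `k ↦ p - 1 - k` from exponents to indices. -/
def expEquiv (p : ℕ) : Fin (p - 1) ≃ Idx p where
  toFun k := ⟨p - 1 - k, by
    have := k.2
    rw [Finset.mem_Icc]
    omega⟩
  invFun i := ⟨p - 1 - i, by
    have := Finset.mem_Icc.1 i.2
    omega⟩
  left_inv k := by
    ext
    have := k.2
    change p - 1 - (p - 1 - (k : ℕ)) = k
    omega
  right_inv i := by
    ext
    have := Finset.mem_Icc.1 i.2
    change p - 1 - (p - 1 - (i : ℕ)) = i
    omega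

/-- The basis `π ^ (p - 2), …, π, 1` of `ℤ[ζ]`. -/
def zetaBasis (p : ℕ) [Fact p.Prime] : Module.Basis (Idx p) ℤ (Zeta p) :=
  (AdjoinRoot.powerBasis' (piPoly_monic p)).basis.reindex
    ((finCongr (show (AdjoinRoot.powerBasis' (piPoly_monic p)).dim = p - 1 from
      piPoly_natDegree p)).trans (expEquiv p))

lemma zetaBasis_apply (p : ℕ) [Fact p.Prime] (i : Idx p) :
    zetaBasis p i = pi' p ^ (p - 1 - (i : ℕ)) := by
  rw [zetaBasis, Module.Basis.reindex_apply, PowerBasis.basis_eq_pow]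
  rfl

lemma p_dvd_pi_pow (p : ℕ) [Fact p.Prime] : (p : Zeta p) ∣ pi' p ^ (p - 1) := by
  obtain ⟨y, -, hy⟩ :=
    (cyclotomic_comp_X_add_one_isEisensteinAt p).isWeaklyEisensteinAt.exists_mem_adjoin_mul_eq_pow_natDegree
      (x := pi' p) (by
        exact (eval₂_piPoly _ p (pi' p)).trans (sum_zeta p)) (piPoly_monic p)
  refine ⟨y, ?_⟩
  rcases subsingleton_or_nontrivial (Zeta p) with h | h
  · exact Subsingleton.elim _ _
  have h2 := (piPoly_monic p).natDegree_map (algebraMap ℤ (Zeta p))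
  rw [piPoly_natDegree] at h2
  rw [← h2]
  refine hy.symm.trans ?_
  simp

lemma dvd_repr (p : ℕ) [Fact p.Prime] (k : ℕ) (a : Zeta p) (i : Idx p) (hi : p - 1 - (i : ℕ) < k) :
    (p : ℤ) ∣ (zetaBasis p).repr (pi' p ^ k * a) i := by
  rw [← (zetaBasis p).sum_repr a, Finset.mul_sum, map_sum, Finsupp.finsetSum_apply]
  refine Finset.dvd_sum fun j _ => ?_
  rw [mul_smul_comm, map_smul, Finsupp.smul_apply, smul_eq_mul]
  refine Dvd.dvd.mul_left ?_ _
  rw [zetaBasis_apply, ← pow_add]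
  rcases lt_or_ge (k + (p - 1 - (j : ℕ))) (p - 1) with h | h
  · have hl : p - 1 - (k + (p - 1 - (j : ℕ))) ∈ Finset.Icc 1 (p - 1) := by
      simp
      omega
    have e : pi' p ^ (k + (p - 1 - (j : ℕ))) = zetaBasis p ⟨_, hl⟩ := by
      rw [zetaBasis_apply]
      congr 1
      simp only
      omega
    rw [e, Module.Basis.repr_self, Finsupp.single_eq_of_ne]
    · exact dvd_zero _
    · intro h'
      have h2 := congrArg (Subtype.val) h'
      simp only at h2
      omega
  · obtain ⟨c, hc⟩ := p_dvd_pi_pow p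
    obtain ⟨d, hd⟩ := Nat.exists_eq_add_of_le h
    rw [hd, pow_add, hc, mul_assoc, ← nsmul_eq_mul, map_nsmul, Finsupp.smul_apply, nsmul_eq_mul]
    exact dvd_mul_right _ _

lemma pi_dvd_gal (p : ℕ) [Fact p.Prime] (u : (ZMod p)ˣ) : pi' p ∣ gal p u (pi' p) := by
  rw [gal_pi]
  have h := sub_one_dvd_pow_sub_one (zeta p) (u : ZMod p).val
  rwa [zeta, add_sub_cancel_right, ← zeta] at h

lemma toMatrix_mem (p : ℕ) [Fact p.Prime] (f : Zeta p →ₗ[ℤ] Zeta p)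
    (hf : ∀ k, pi' p ^ k ∣ f (pi' p ^ k)) :
    LinearMap.toMatrix (zetaBasis p) (zetaBasis p) f ∈ Tri p := by
  intro i j h
  rw [LinearMap.toMatrix_apply, zetaBasis_apply]
  obtain ⟨a, ha⟩ := hf (p - 1 - (j : ℕ))
  rw [ha]
  have hi := Finset.mem_Icc.1 i.2
  have h' : (j : ℕ) < i := h
  exact dvd_repr p _ a i (by omega)

/-- The matrix by which `x` acts. -/
def matX (p : ℕ) [Fact p.Prime] : Tri p :=
  ⟨LinearMap.toMatrix (zetaBasis p) (zetaBasis p) (LinearMap.mulLeft ℤ (zeta p)),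
    toMatrix_mem p _ fun k => by
      rw [LinearMap.mulLeft_apply]
      exact dvd_mul_left _ _⟩

/-- The matrix by which `y` acts. -/
def matY (p : ℕ) [Fact p.Prime] (u : (ZMod p)ˣ) : Tri p :=
  ⟨LinearMap.toMatrix (zetaBasis p) (zetaBasis p) (gal p u).toLinearMap,
    toMatrix_mem p _ fun k => by
      rw [AlgHom.toLinearMap_apply, map_pow]
      exact pow_dvd_pow_of_dvd (pi_dvd_gal p u) k⟩

lemma matX_pow_val (p : ℕ) [Fact p.Prime] (k : ℕ) :
    (matX p ^ k).1 =
      LinearMap.toMatrix (zetaBasis p) (zetaBasis p) (LinearMap.mulLeft ℤ (zeta p ^ k)) := by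
  rw [← LinearMap.pow_mulLeft]
  exact LinearMap.toMatrix_pow _ _ _

lemma matX_pow (p : ℕ) [Fact p.Prime] : matX p ^ p = 1 := by
  apply Subtype.ext
  rw [matX_pow_val, zeta_pow, LinearMap.mulLeft_one, LinearMap.toMatrix_id]
  rfl

lemma matY_mul (p : ℕ) [Fact p.Prime] (u v : (ZMod p)ˣ) :
    matY p (u * v) = matY p u * matY p v := by
  apply Subtype.ext
  change LinearMap.toMatrix _ _ _ = LinearMap.toMatrix _ _ _ * LinearMap.toMatrix _ _ _
  rw [← LinearMap.toMatrix_comp]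
  congr 1
  ext a
  exact gal_mul p u v a

lemma matY_one (p : ℕ) [Fact p.Prime] : matY p 1 = 1 := by
  apply Subtype.ext
  have h : (gal p 1).toLinearMap = LinearMap.id := LinearMap.ext (gal_one p)
  change LinearMap.toMatrix _ _ _ = _
  rw [h, LinearMap.toMatrix_id]
  rfl

lemma matY_pow (p : ℕ) [hp : Fact p.Prime] (u : (ZMod p)ˣ) : matY p u ^ (p - 1) = 1 := by
  have h : ∀ k, matY p u ^ k = matY p (u ^ k) := by
    intro k
    induction k with
    | zero => rw [pow_zero, pow_zero, matY_one]
    | succ k ih => rw [pow_succ, pow_succ, matY_mul, ih]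
  rw [h, ZMod.units_pow_card_sub_one_eq_one, matY_one]

lemma matY_mul_matX (p : ℕ) [Fact p.Prime] (u : (ZMod p)ˣ) :
    matY p u * matX p = matX p ^ (u : ZMod p).val * matY p u := by
  apply Subtype.ext
  rw [Subring.coe_mul, Subring.coe_mul, matX_pow_val]
  change LinearMap.toMatrix _ _ _ * LinearMap.toMatrix _ _ _ =
    LinearMap.toMatrix _ _ _ * LinearMap.toMatrix _ _ _
  rw [← LinearMap.toMatrix_comp, ← LinearMap.toMatrix_comp]
  congr 1
  ext a
  change gal p u (zeta p * a) = zeta p ^ (u : ZMod p).val * gal p u a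
  rw [map_mul, gal_zeta]

/-- `matX` as a unit of `𝒯_{p-1}(ℤ, p)`. -/
def unitX (p : ℕ) [hp : Fact p.Prime] : (Tri p)ˣ :=
  Units.ofPowEqOne (matX p) p (matX_pow p) hp.out.ne_zero

/-- `matY` as a unit of `𝒯_{p-1}(ℤ, p)`. -/
def unitY (p : ℕ) [hp : Fact p.Prime] (u : (ZMod p)ˣ) : (Tri p)ˣ :=
  Units.ofPowEqOne (matY p u) (p - 1) (matY_pow p u) (by have := hp.out.two_le; omega)

/-- The homomorphism `G(p, p - 1) → 𝒯_{p-1}(ℤ, p)ˣ`. -/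
def groupRep (p : ℕ) [Fact p.Prime] (u : (ZMod p)ˣ) : G p u →* (Tri p)ˣ :=
  PresentedGroup.toGroup (f := ![unitX p, unitY p u]) (by
    intro r hr
    rcases hr with rfl | rfl | rfl
    · simp only [map_pow, FreeGroup.lift_apply_of, Matrix.cons_val_zero]
      exact Units.ext (matX_pow p)
    · simp only [map_pow, FreeGroup.lift_apply_of, Matrix.cons_val_one]
      exact Units.ext (matY_pow p u)
    · simp only [map_mul, map_inv, map_pow, FreeGroup.lift_apply_of, Matrix.cons_val_zero,
        Matrix.cons_val_one]
      rw [mul_inv_eq_one]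
      exact Units.ext (matY_mul_matX p u))

/-- The ring homomorphism `Λ → 𝒯_{p-1}(ℤ, p)`. -/
def latticeRep (p : ℕ) [Fact p.Prime] (u : (ZMod p)ˣ) : Lam p u →+* Tri p :=
  (MonoidAlgebra.lift ℤ (Tri p) (G p u) ((Units.coeHom (Tri p)).comp (groupRep p u))).toRingHom

/-- `R(k)` as a right `Λ`-module. -/
instance rowLamModule (p k : ℕ) [Fact p.Prime] (u : (ZMod p)ˣ) : Module (Lam p u)ᵐᵒᵖ (Row p k) :=
  Module.compHom (Row p k) (latticeRep p u).op

lemma row_smul_def (p k : ℕ) [Fact p.Prime] (u : (ZMod p)ˣ) (a : (Lam p u)ᵐᵒᵖ) (v : Row p k) :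
    ((a • v : Row p k) : Idx p → ℤ) = Matrix.vecMul (v : Idx p → ℤ) (latticeRep p u a.unop).1 :=
  rfl

/-! ### The modules `R(1̂)` and `R(2) ⊕ R(1̂)` and endomorphisms given by matrices -/

/-- `R(k̂)`, the direct sum of the rows `R(i)` with `1 ≤ i ≤ p - 1`, `i ≠ k`. -/
abbrev RowHat (p k : ℕ) : Type := (i : ↥((Finset.Icc 1 (p - 1)).erase k)) → Row p i

/-- `R(2) ⊕ R(1̂) = R(2) ⊕ R(2) ⊕ R(3) ⊕ ⋯ ⊕ R(p - 1)`. -/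
abbrev RSum (p : ℕ) : Type := Row p 2 × RowHat p 1

/-- The row index of the `i`-th summand of `R(2) ⊕ R(2) ⊕ R(3) ⊕ ⋯ ⊕ R(p - 1)`. -/
def rowOf (p : ℕ) (i : Idx p) : ℕ := if (i : ℕ) = 1 then 2 else i

/-- The `i`-th component of an element of `R(2) ⊕ R(2) ⊕ R(3) ⊕ ⋯ ⊕ R(p - 1)`, as a row vector. -/
def component (p : ℕ) (v : RSum p) (i : Idx p) : Idx p → ℤ :=
  if h : (i : ℕ) = 1 then v.1 else v.2 ⟨i, Finset.mem_erase.2 ⟨h, i.2⟩⟩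

/-- The integral matrices that define endomorphisms of `R(2) ⊕ R(2) ⊕ R(3) ⊕ ⋯ ⊕ R(p - 1)`:
multiplication by `n` maps `R(j)` to `R(i)` when `i ≤ j` or `p ∣ n`. -/
def IsEndMatrix (p : ℕ) (A : Matrix (Idx p) (Idx p) ℤ) : Prop :=
  ∀ i j, rowOf p j < rowOf p i → (p : ℤ) ∣ A i j

lemma component_mem (p : ℕ) (v : RSum p) (i : Idx p) : component p v i ∈ Row p (rowOf p i) := by
  unfold component rowOf
  split_ifs with h
  · exact v.1.2
  · exact (v.2 ⟨i, Finset.mem_erase.2 ⟨h, i.2⟩⟩).2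

lemma sum_component_mem (p : ℕ) {A : Matrix (Idx p) (Idx p) ℤ} (hA : IsEndMatrix p A)
    (v : RSum p) (i : Idx p) : ∑ j, A i j • component p v j ∈ Row p (rowOf p i) := by
  refine AddSubgroup.sum_mem _ fun j _ => ?_
  intro l hl
  rw [Pi.smul_apply, smul_eq_mul]
  rcases lt_or_ge (rowOf p j) (rowOf p i) with h | h
  · exact Dvd.dvd.mul_right (hA i j h) _
  · exact Dvd.dvd.mul_left (component_mem p v j l (hl.trans_le h)) _

lemma component_add (p : ℕ) (v w : RSum p) (i : Idx p) :
    component p (v + w) i = component p v i + component p w i := by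
  unfold component
  split_ifs <;> rfl

lemma component_smul (p : ℕ) [Fact p.Prime] (u : (ZMod p)ˣ) (a : (Lam p u)ᵐᵒᵖ) (v : RSum p)
    (i : Idx p) :
    component p (a • v) i = Matrix.vecMul (component p v i) (latticeRep p u a.unop).1 := by
  unfold component
  split_ifs <;> rfl

lemma component_ext (p : ℕ) {v w : RSum p} (hp : 1 ≤ p - 1)
    (h : ∀ i, component p v i = component p w i) : v = w := by
  refine Prod.ext (Subtype.ext ?_) (funext fun i => Subtype.ext ?_)
  · simpa [component] using h ⟨1, by simpa using hp⟩
  · have hi := Finset.mem_erase.1 i.2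
    simpa [component, hi.1] using h ⟨i, hi.2⟩

/-- The element of `R(2) ⊕ R(2) ⊕ R(3) ⊕ ⋯ ⊕ R(p - 1)` with the components `f i`. -/
def ofComponents (p : ℕ) (hp : 1 ≤ p - 1) (f : Idx p → Idx p → ℤ)
    (hf : ∀ i, f i ∈ Row p (rowOf p i)) : RSum p :=
  (⟨f ⟨1, by simpa using hp⟩, by simpa [rowOf] using hf ⟨1, by simpa using hp⟩⟩,
    fun i => ⟨f ⟨i, (Finset.mem_erase.1 i.2).2⟩, by
      simpa [rowOf, (Finset.mem_erase.1 i.2).1] using hf ⟨i, (Finset.mem_erase.1 i.2).2⟩⟩)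

lemma component_ofComponents (p : ℕ) (hp : 1 ≤ p - 1) (f : Idx p → Idx p → ℤ)
    (hf : ∀ i, f i ∈ Row p (rowOf p i)) (i : Idx p) :
    component p (ofComponents p hp f hf) i = f i := by
  obtain ⟨i, hi⟩ := i
  unfold component ofComponents
  split_ifs with h
  · simp only at h
    subst h
    rfl
  · rfl

lemma one_le_pred (p : ℕ) [hp : Fact p.Prime] : 1 ≤ p - 1 := by
  have := hp.out.two_le
  omega

/-- The endomorphism of `R(2) ⊕ R(2) ⊕ R(3) ⊕ ⋯ ⊕ R(p - 1)` given by a matrix `A`, acting on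
columns of components: the `i`-th component of the image of `v` is `∑ j, A i j • v_j`. -/
def endOfMatrix (p : ℕ) [Fact p.Prime] (u : (ZMod p)ˣ) (A : Matrix (Idx p) (Idx p) ℤ)
    (hA : IsEndMatrix p A) : RSum p →ₗ[(Lam p u)ᵐᵒᵖ] RSum p where
  toFun v := ofComponents p (one_le_pred p) (fun i => ∑ j, A i j • component p v j)
    (sum_component_mem p hA v)
  map_add' v w := by
    refine component_ext p (one_le_pred p) fun i => ?_
    simp only [component_add, component_ofComponents, smul_add, Finset.sum_add_distrib]
  map_smul' a v := by
    refine component_ext p (one_le_pred p) fun i => ?_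
    simp only [component_smul, component_ofComponents, RingHom.id_apply]
    rw [Matrix.sum_vecMul]
    simp only [Matrix.smul_vecMul]

/-- The matrices
`(0, a₁₂; 0, a₂₂) ⊕ diag(a₃₃, …, a_{p-1,p-1})` with all entries in `{0, …, p - 1}`. -/
structure IsSparse (p : ℕ) (A : Matrix (Idx p) (Idx p) ℤ) : Prop where
  nonneg : ∀ i j, 0 ≤ A i j
  le : ∀ i j, A i j ≤ (p : ℤ) - 1
  eq_zero : ∀ i j : Idx p, ¬ ((i : ℕ) = 1 ∧ (j : ℕ) = 2) → ¬ (i = j ∧ 2 ≤ (i : ℕ)) → A i j = 0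

lemma IsSparse.isEndMatrix {p : ℕ} {A : Matrix (Idx p) (Idx p) ℤ} (hA : IsSparse p A) :
    IsEndMatrix p A := by
  intro i j h
  rw [hA.eq_zero i j]
  · exact dvd_zero _
  · rintro ⟨hi, hj⟩
    simp [rowOf, hi, hj] at h
  · rintro ⟨rfl, -⟩
    exact lt_irrefl _ h

/-! ### The standard extension and push-forward -/

/-- The short complex `R(2) ⊕ R(1̂) → R(2) ⊕ [y - 1) → I(C_{p-1})` of right `Λ`-modules built from
`ι : R(1̂) → [y - 1)` and the canonical map `[y - 1) → I(C_{p-1})`: the first map is `id ⊕ ι` and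
the second map is zero on `R(2)`. -/
def stdComplex (p : ℕ) [Fact p.Prime] (u : (ZMod p)ˣ)
    (ι : RowHat p 1 →ₗ[(Lam p u)ᵐᵒᵖ] yIdeal p u) (hex : Function.Exact ι (yToAug p u)) :
    ShortComplex (ModuleCat.{0} (Lam p u)ᵐᵒᵖ) :=
  ShortComplex.mk
    (X₁ := ModuleCat.of (Lam p u)ᵐᵒᵖ (RSum p))
    (X₂ := ModuleCat.of (Lam p u)ᵐᵒᵖ (Row p 2 × yIdeal p u))
    (X₃ := ModuleCat.of (Lam p u)ᵐᵒᵖ (augIdeal p u))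
    (ModuleCat.ofHom (LinearMap.prodMap LinearMap.id ι))
    (ModuleCat.ofHom ((yToAug p u).comp (LinearMap.snd (Lam p u)ᵐᵒᵖ (Row p 2) (yIdeal p u))))
    (by
      refine ModuleCat.hom_ext (LinearMap.ext fun v => ?_)
      exact hex.apply_apply_eq_zero v.2)

lemma stdComplex_shortExact (p : ℕ) [Fact p.Prime] (u : (ZMod p)ˣ)
    (ι : RowHat p 1 →ₗ[(Lam p u)ᵐᵒᵖ] yIdeal p u) (hι : Function.Injective ι)
    (hex : Function.Exact ι (yToAug p u)) : (stdComplex p u ι hex).ShortExact := by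
  refine ModuleCat.shortComplex_shortExact (stdComplex p u ι hex) ?_ ?_ ?_
  · rintro ⟨r, a⟩
    change yToAug p u a = 0 ↔ _
    rw [hex a]
    constructor
    · rintro ⟨b, rfl⟩
      exact ⟨(r, b), rfl⟩
    · rintro ⟨⟨r', b⟩, hb⟩
      exact ⟨b, congrArg Prod.snd hb⟩
  · exact Function.Injective.prodMap Function.injective_id hι
  · intro a
    obtain ⟨b, hb⟩ := yToAug_surjective p u a
    exact ⟨(0, b), hb⟩

/-- `Ext¹_Λ(I(C_{p-1}), R(2) ⊕ R(1̂))`, for right `Λ`-modules. -/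
abbrev ExtOne (p : ℕ) [Fact p.Prime] (u : (ZMod p)ˣ) : Type :=
  Abelian.Ext.{0} (ModuleCat.of (Lam p u)ᵐᵒᵖ (augIdeal p u))
    (ModuleCat.of (Lam p u)ᵐᵒᵖ (RSum p)) 1

/-- The class `α_*(ℰ)` of the push-out of the extension
`ℰ = (0 → R(2) ⊕ R(1̂) → R(2) ⊕ [y - 1) → I(C_{p-1}) → 0)` along an endomorphism `α` of
`R(2) ⊕ R(1̂)`: the image of the class of `ℰ` under the map that `α` induces on `Ext¹`. -/
def pushExt (p : ℕ) [Fact p.Prime] (u : (ZMod p)ˣ)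
    (ι : RowHat p 1 →ₗ[(Lam p u)ᵐᵒᵖ] yIdeal p u) (hι : Function.Injective ι)
    (hex : Function.Exact ι (yToAug p u)) (α : RSum p →ₗ[(Lam p u)ᵐᵒᵖ] RSum p) : ExtOne p u :=
  Abelian.Ext.comp (stdComplex_shortExact p u ι hι hex).extClass
    (Abelian.Ext.mk₀ (ModuleCat.ofHom α)) (add_zero 1)

end

end Metacyclic

namespace Metacyclic

noncomputable section

/-! ### Row vectors and multiplication by `X - 1` -/

section Rows

variable (p : ℕ) [Fact p.Prime]

/-! Apply the contravariant long exact sequence of `Ext` to `ℰ`. Since `Ext¹([y - 1), R(2) ⊕ R(1̂))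
= 0` (`ext_yIdeal_eq_zero`), every class is a push-out of `ℰ` along some endomorphism `φ`. The
push-out is trivial exactly when `φ` extends along `id ⊕ ι`. The first summand `R(2)` imposes no
condition, so it remains to decide when a homomorphism `h : R(1̂) → R(k)` extends along `ι`.

The image of `ι` is `(y - 1)(x - 1)Λ = [y - 1)(x - 1)`, because `(x - 1)Λ = Λ(x - 1)`. As `x - 1`
acts injectively on `R(k)`, `h` extends iff its values lie in `R(k)(x - 1)`
(`exists_comp_iota_iff`), which consists of the vectors of `R(k)` whose `k`-th entry is divisible by
`p`. A homomorphism `R(j) → R(k)` is multiplication by an integer (`row_hom_apply`). For `j ≠ k` the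
divisibility is automatic, so only the scalar on the summand `R(k)` matters, and only modulo `p`
(`forall_dvd_iff`). Hence a push-out is determined by one residue modulo `p` for each of the `p - 1`
target summands (`pushExt_eq_zero_iff_dvd`). The sparse matrices have exactly one free entry for
each of them: both copies of `R(2)` in the target read the same source `R(2)` in `R(1̂)`, which
gives the entries `(1, 2)` and `(2, 2)`.

Two facts about `Λ` support this. The map `Λ → 𝒯` is surjective (`latticeRep_surjective`), so that
`Λ`-homomorphisms between rows are `𝒯`-homomorphisms. The map `Λ → ℤ[C_{p-1}] × 𝒯` is injective
(`eq_zero_of_latticeRep_eq_zero`), which with surjectivity produces `ι`. -/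

lemma matX_sub_one :
    ((matX p).1 - 1 : Matrix (Idx p) (Idx p) ℤ) =
      LinearMap.toMatrix (zetaBasis p) (zetaBasis p) (LinearMap.mulLeft ℤ (pi' p)) := by
  rw [← LinearMap.toMatrix_id (zetaBasis p)]
  change LinearMap.toMatrix _ _ _ - LinearMap.toMatrix _ _ _ = _
  rw [← map_sub]
  congr 1
  ext a
  simp [zeta, add_mul]

/-- The coordinate column of `π ^ (p - 1)`. -/
def piCol (i : Idx p) : ℤ := (zetaBasis p).repr (pi' p ^ (p - 1)) i

lemma one_mem_idx : 1 ∈ Finset.Icc 1 (p - 1) := Finset.mem_Icc.2 ⟨le_rfl, one_le_pred p⟩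

lemma last_mem_idx : p - 1 ∈ Finset.Icc 1 (p - 1) := Finset.mem_Icc.2 ⟨one_le_pred p, le_rfl⟩

lemma dvd_piCol (i : Idx p) : (p : ℤ) ∣ piCol p i := by
  have hi := Finset.mem_Icc.1 i.2
  have := dvd_repr p (p - 1) 1 i (by omega)
  rwa [mul_one] at this

lemma eval_piPoly_zero : (piPoly p).coeff 0 = p := by
  rw [Polynomial.coeff_zero_eq_eval_zero, ← Polynomial.eval₂_id, eval₂_piPoly]
  simp

/-- The last basis vector is `1`, and the constant term of the minimal polynomial of `π` is `Φ_p(1)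
= p`. -/
lemma piCol_last : piCol p ⟨p - 1, last_mem_idx p⟩ = -p := by
  have h1 : pi' p ^ (p - 1) = ∑ i : Idx p, (-(piPoly p).coeff (p - 1 - i)) • zetaBasis p i := by
    have h : Polynomial.aeval (pi' p) (piPoly p) = 0 := AdjoinRoot.eval₂_root _
    replace h := (congrArg (Polynomial.aeval (pi' p)) (piPoly_monic p).as_sum).symm.trans h
    rw [piPoly_natDegree] at h
    simp only [map_add, map_pow, Polynomial.aeval_X, map_sum, map_mul, Polynomial.aeval_C] at h
    rw [eq_neg_of_add_eq_zero_left h, Finset.sum_range, ← Finset.sum_neg_distrib]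
    refine Fintype.sum_equiv (expEquiv p) _ _ fun k => ?_
    have hk : p - 1 - (p - 1 - (k : ℕ)) = k := by have := k.2; omega
    rw [zetaBasis_apply]
    change _ = -(piPoly p).coeff (p - 1 - (p - 1 - (k : ℕ))) • pi' p ^ (p - 1 - (p - 1 - (k : ℕ)))
    rw [hk, neg_smul, Algebra.smul_def]
  rw [piCol, h1, map_sum, Finsupp.finsetSum_apply]
  simp only [map_smul, Module.Basis.repr_self, Finsupp.smul_apply, smul_eq_mul,
    Finsupp.single_apply, mul_ite, mul_one, mul_zero, Finset.sum_ite_eq', Finset.mem_univ, if_true]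
  rw [Nat.sub_self, eval_piPoly_zero]

/-- `X - 1` is multiplication by `π`, a companion matrix. Since exponents decrease along the basis,
right multiplication by it shifts the entries of a row one place to the right, and only column `1`
sees `π ^ (p - 1)`. -/
lemma matX_sub_one_apply (i j : Idx p) :
    ((matX p).1 - 1) i j =
      if (j : ℕ) = 1 then piCol p i else if (i : ℕ) + 1 = j then 1 else 0 := by
  rw [matX_sub_one, LinearMap.toMatrix_apply, LinearMap.mulLeft_apply, zetaBasis_apply, ← pow_succ']
  have hj := Finset.mem_Icc.1 j.2
  have hi := Finset.mem_Icc.1 i.2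
  split_ifs with h h'
  · rw [piCol]
    congr 3
    omega
  all_goals
    have hl : (j : ℕ) - 1 ∈ Finset.Icc 1 (p - 1) := by
      simp
      omega
    have e : pi' p ^ (p - 1 - (j : ℕ) + 1) = zetaBasis p ⟨_, hl⟩ := by
      rw [zetaBasis_apply]
      congr 1
      simp only
      omega
    rw [e, Module.Basis.repr_self, Finsupp.single_apply]
  · rw [if_pos]
    ext
    simp only
    omega
  · rw [if_neg]
    intro h2
    have h2 := congrArg (Subtype.val) h2
    simp only at h2
    omega

lemma vecMul_one_apply (w : Idx p → ℤ) :
    Matrix.vecMul w ((matX p).1 - 1) ⟨1, one_mem_idx p⟩ = ∑ i, w i * piCol p i := by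
  simp only [Matrix.vecMul, dotProduct, matX_sub_one_apply, if_true]

lemma vecMul_succ_apply (w : Idx p → ℤ) (i j : Idx p) (h : (i : ℕ) + 1 = j) :
    Matrix.vecMul w ((matX p).1 - 1) j = w i := by
  have hi := Finset.mem_Icc.1 i.2
  simp only [Matrix.vecMul, dotProduct, matX_sub_one_apply]
  rw [Finset.sum_eq_single i]
  · rw [if_neg (by omega), if_pos h, mul_one]
  · intro k _ hk
    rw [if_neg (by omega), if_neg, mul_zero]
    intro h2
    exact hk (Subtype.ext (by omega))
  · simp

lemma vecMul_mem_row_succ (k : ℕ) (w : Idx p → ℤ) (hw : w ∈ Row p k) :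
    Matrix.vecMul w ((matX p).1 - 1) ∈ Row p (k + 1) := by
  rintro ⟨j, hj⟩ hjk
  have hj' := Finset.mem_Icc.1 hj
  simp only at hjk
  rcases eq_or_ne j 1 with rfl | h1
  · rw [vecMul_one_apply]
    exact Finset.dvd_sum fun i _ => (dvd_piCol p i).mul_left _
  · rw [vecMul_succ_apply p w ⟨j - 1, Finset.mem_Icc.2 (by omega)⟩ _
      (show j - 1 + 1 = j by omega)]
    exact hw _ (show j - 1 < k by omega)

lemma sum_idx_split (f : Idx p → ℤ) :
    ∑ i, f i = f ⟨p - 1, last_mem_idx p⟩ + ∑ i ∈ Finset.univ.erase ⟨p - 1, last_mem_idx p⟩, f i :=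
  (Finset.add_sum_erase _ _ (Finset.mem_univ _)).symm

/-- The shift forgets only the last entry of `w`, which column `1` recovers through the factor `-p`.
-/
lemma vecMul_matX_sub_one_injective :
    Function.Injective fun w : Idx p → ℤ => Matrix.vecMul w ((matX p).1 - 1) := by
  have key : ∀ w : Idx p → ℤ, Matrix.vecMul w ((matX p).1 - 1) = 0 → w = 0 := by
    intro w hw
    have h1 : ∀ i : Idx p, (i : ℕ) ≠ p - 1 → w i = 0 := by
      intro i hi
      have hi' := Finset.mem_Icc.1 i.2
      rw [← vecMul_succ_apply p w i ⟨i + 1, Finset.mem_Icc.2 (by omega)⟩ rfl, hw]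
      rfl
    have h2 := vecMul_one_apply p w
    rw [hw, sum_idx_split, Finset.sum_eq_zero, piCol_last] at h2
    · funext i
      by_cases hi : (i : ℕ) = p - 1
      · have : i = ⟨p - 1, last_mem_idx p⟩ := Subtype.ext hi
        rw [this]
        have hp : p ≠ 0 := (Fact.out : p.Prime).ne_zero
        simpa [hp] using h2.symm
      · exact h1 i hi
    · intro i hi
      rw [h1 i, zero_mul]
      intro h
      exact (Finset.mem_erase.1 hi).1 (Subtype.ext h)
  intro v w h
  have := key (v - w) (by rw [Matrix.sub_vecMul]; exact sub_eq_zero.2 h)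
  exact sub_eq_zero.1 this

/-- With `vecMul_mem_row_succ` this gives `R(k)(X - 1) = R(k + 1)`, where for `k = p - 1` the right
side means `pℤ^{p-1}`. Shift `v` back by one place; the last entry of `w` is still free and is used
to adjust column `1`. -/
lemma exists_vecMul_matX_sub_one (k : ℕ) (hk : k ∈ Finset.Icc 1 (p - 1)) (v : Idx p → ℤ) (hv : v ∈ Row p (k + 1)) :
    ∃ w ∈ Row p k, Matrix.vecMul w ((matX p).1 - 1) = v := by
  have hk' := Finset.mem_Icc.1 hk
  let w₀ : Idx p → ℤ := fun i =>
    if h : (i : ℕ) + 1 ∈ Finset.Icc 1 (p - 1) then v ⟨i + 1, h⟩ else 0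
  have hp0 : (p : ℤ) ∣ v ⟨1, one_mem_idx p⟩ := hv _ (show 1 < k + 1 by omega)
  -- Adding `c` to the last entry changes column `1` by `-p * c`, so the error there only has to be
  -- a multiple of `p`.
  obtain ⟨c, hc⟩ : (p : ℤ) ∣ ∑ i, w₀ i * piCol p i - v ⟨1, one_mem_idx p⟩ :=
    dvd_sub (Finset.dvd_sum fun i _ => (dvd_piCol p i).mul_left _) hp0
  have hw₀ : ∀ i j : Idx p, (i : ℕ) + 1 = j → w₀ i = v j := by
    rintro i ⟨j, hj⟩ h
    simp only at h
    subst h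
    simp only [w₀]
    rw [dif_pos hj]
  have e : Matrix.vecMul (w₀ + c • Pi.single ⟨p - 1, last_mem_idx p⟩ 1) ((matX p).1 - 1) = v := by
    funext j
    have hj := Finset.mem_Icc.1 j.2
    by_cases h1 : (j : ℕ) = 1
    · have : j = ⟨1, one_mem_idx p⟩ := Subtype.ext h1
      rw [this, vecMul_one_apply]
      simp only [Pi.add_apply, Pi.smul_apply, smul_eq_mul, add_mul, Finset.sum_add_distrib,
        Pi.single_apply, mul_ite, mul_one, mul_zero, ite_mul, zero_mul, Finset.sum_ite_eq',
        Finset.mem_univ, if_true, piCol_last]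
      linear_combination hc
    · have hi : (j : ℕ) - 1 ∈ Finset.Icc 1 (p - 1) := Finset.mem_Icc.2 (by omega)
      have hij : (j : ℕ) - 1 + 1 = j := by omega
      rw [vecMul_succ_apply p _ ⟨j - 1, hi⟩ j hij, Pi.add_apply, hw₀ _ j hij, Pi.smul_apply,
        Pi.single_eq_of_ne, smul_zero, add_zero]
      intro h2
      have h2 := congrArg (Subtype.val) h2
      simp only at h2
      omega
  generalize w₀ + c • Pi.single ⟨p - 1, last_mem_idx p⟩ 1 = w at e
  refine ⟨w, ?_, e⟩
  intro j hj
  have hj' : (j : ℕ) + 1 ∈ Finset.Icc 1 (p - 1) := Finset.mem_Icc.2 (by omega)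
  rw [← vecMul_succ_apply p w j ⟨j + 1, hj'⟩ rfl, e]
  exact hv _ (show (j : ℕ) + 1 < k + 1 by omega)

end Rows

/-! ### The group ring and the kernels of the projections -/

section GroupRing

variable (p : ℕ) (u : (ZMod p)ˣ)

lemma gx_pow : gx p u ^ p = 1 := by
  have := PresentedGroup.one_of_mem (rels := relators p u) (x := FreeGroup.of 0 ^ p) (by
    simp [relators])
  rwa [map_pow] at this

lemma gy_pow : gy p u ^ (p - 1) = 1 := by
  have := PresentedGroup.one_of_mem (rels := relators p u) (x := FreeGroup.of 1 ^ (p - 1)) (by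
    simp [relators])
  rwa [map_pow] at this

lemma gy_mul_gx : gy p u * gx p u = gx p u ^ (u : ZMod p).val * gy p u := by
  have := PresentedGroup.mk_eq_mk_of_mul_inv_mem (rels := relators p u)
    (x := FreeGroup.of 1 * FreeGroup.of 0)
    (y := FreeGroup.of 0 ^ (u : ZMod p).val * FreeGroup.of 1) (by simp [relators])
  rwa [map_mul, map_mul, map_pow] at this

lemma gx_pow_mod (k : ℕ) : gx p u ^ (k % p) = gx p u ^ k := by
  conv_rhs => rw [← Nat.mod_add_div k p, pow_add, pow_mul, gx_pow, one_pow, mul_one]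

lemma gx_pow_congr {a b : ℕ} (h : (a : ZMod p) = b) : gx p u ^ a = gx p u ^ b := by
  rw [← gx_pow_mod, ← gx_pow_mod p u b, (ZMod.natCast_eq_natCast_iff' a b p).1 h]

lemma gy_pow_mod (k : ℕ) : gy p u ^ (k % (p - 1)) = gy p u ^ k := by
  conv_rhs => rw [← Nat.mod_add_div k (p - 1), pow_add, pow_mul, gy_pow, one_pow, mul_one]

lemma gy_mul_gx_pow (a : ℕ) :
    gy p u * gx p u ^ a = gx p u ^ ((u : ZMod p).val * a) * gy p u := by
  induction a with
  | zero => simp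
  | succ a ih =>
    rw [pow_succ, ← mul_assoc, ih, mul_assoc, gy_mul_gx, ← mul_assoc, ← pow_add, Nat.mul_succ]

lemma gy_pow_mul_gx_pow [NeZero p] (k a : ℕ) :
    gy p u ^ k * gx p u ^ a = gx p u ^ (((u ^ k : (ZMod p)ˣ) : ZMod p).val * a) * gy p u ^ k := by
  induction k with
  | zero =>
    simp only [pow_zero, one_mul, mul_one, Units.val_one]
    apply gx_pow_congr
    simp
  | succ k ih =>
    rw [pow_succ', mul_assoc, ih, ← mul_assoc, gy_mul_gx_pow, mul_assoc]
    congr 1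
    apply gx_pow_congr
    simp [pow_succ']
    ring

lemma gx_mul_gy_pow [NeZero p] (k : ℕ) :
    gx p u * gy p u ^ k = gy p u ^ k * gx p u ^ (((u ^ k)⁻¹ : (ZMod p)ˣ) : ZMod p).val := by
  rw [gy_pow_mul_gx_pow]
  congr 1
  conv_lhs => rw [← pow_one (gx p u)]
  apply gx_pow_congr
  rw [Nat.cast_one, Nat.cast_mul, ZMod.natCast_zmod_val, ZMod.natCast_zmod_val, Units.mul_inv]

/-- The normal form `x ^ a y ^ k`. -/
lemma exists_normal_form [Fact p.Prime] (g : G p u) : ∃ a k, g = gx p u ^ a * gy p u ^ k := by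
  have hx : ∀ h : G p u, (∃ a k, h = gx p u ^ a * gy p u ^ k) →
      ∃ a k, gx p u * h = gx p u ^ a * gy p u ^ k := by
    rintro _ ⟨a, k, rfl⟩
    exact ⟨a + 1, k, by rw [pow_succ', mul_assoc]⟩
  have hy : ∀ h : G p u, (∃ a k, h = gx p u ^ a * gy p u ^ k) →
      ∃ a k, gy p u * h = gx p u ^ a * gy p u ^ k := by
    rintro _ ⟨a, k, rfl⟩
    exact ⟨_, k + 1, by rw [← mul_assoc, gy_mul_gx_pow, mul_assoc, ← pow_succ']⟩
  have iter : ∀ (s : G p u) (_ : ∀ h : G p u, (∃ a k, h = gx p u ^ a * gy p u ^ k) →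
      ∃ a k, s * h = gx p u ^ a * gy p u ^ k) (n : ℕ) (h : G p u),
      (∃ a k, h = gx p u ^ a * gy p u ^ k) → ∃ a k, s ^ n * h = gx p u ^ a * gy p u ^ k := by
    intro s hs n
    induction n with
    | zero => simp
    | succ n ih =>
      intro h hh
      rw [pow_succ, mul_assoc]
      exact ih _ (hs _ hh)
  have hp := (Fact.out : p.Prime).two_le
  have hxi : (gx p u)⁻¹ = gx p u ^ (p - 1) := by
    rw [inv_eq_iff_mul_eq_one, ← pow_succ', Nat.sub_add_cancel (by omega), gx_pow]
  have hyi : (gy p u)⁻¹ = gy p u ^ (p - 2) := by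
    rw [inv_eq_iff_mul_eq_one, ← pow_succ', show p - 2 + 1 = p - 1 by omega, gy_pow]
  have hg : g ∈ Subgroup.closure (Set.range (PresentedGroup.of (rels := relators p u))) := by
    rw [PresentedGroup.closure_range_of]
    trivial
  induction hg using Subgroup.closure_induction_left with
  | one => exact ⟨0, 0, by simp⟩
  | mul_left s hs h _ ih =>
    obtain ⟨i, rfl⟩ := hs
    fin_cases i
    · exact hx _ ih
    · exact hy _ ih
  | inv_mul_cancel s hs h _ ih =>
    obtain ⟨i, rfl⟩ := hs
    fin_cases i
    · change ∃ a k, (gx p u)⁻¹ * h = _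
      rw [hxi]
      exact iter _ hx _ _ ih
    · change ∃ a k, (gy p u)⁻¹ * h = _
      rw [hyi]
      exact iter _ hy _ _ ih

lemma exists_mul_gx [Fact p.Prime] (g : G p u) : ∃ c, g * gx p u = gx p u ^ c * g := by
  obtain ⟨a, k, rfl⟩ := exists_normal_form p u g
  have h := gy_pow_mul_gx_pow p u k 1
  rw [pow_one] at h
  refine ⟨((u ^ k : (ZMod p)ˣ) : ZMod p).val * 1, ?_⟩
  rw [mul_assoc, h, ← mul_assoc, ← mul_assoc, ← pow_add, ← pow_add, add_comm]

lemma exists_gx_mul [Fact p.Prime] (g : G p u) : ∃ c, gx p u * g = g * gx p u ^ c := by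
  obtain ⟨a, k, rfl⟩ := exists_normal_form p u g
  refine ⟨(((u ^ k)⁻¹ : (ZMod p)ˣ) : ZMod p).val, ?_⟩
  rw [← mul_assoc, ← pow_succ', pow_succ, mul_assoc, gx_mul_gy_pow, mul_assoc]

/-- The element `x` of `Λ`. -/
def lx : Lam p u := MonoidAlgebra.of ℤ (G p u) (gx p u)

/-- The element `y` of `Λ`. -/
def ly : Lam p u := MonoidAlgebra.of ℤ (G p u) (gy p u)

lemma toC_gx : toC p u (gx p u) = 1 := by simp [toC, gx]

lemma toC_gy : toC p u (gy p u) = cy p := by simp [toC, gy]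

lemma toZC_of (g : G p u) :
    toZC p u (MonoidAlgebra.of ℤ (G p u) g) = MonoidAlgebra.of ℤ (C p) (toC p u g) := by
  simp [toZC, MonoidAlgebra.of_apply]

lemma toZC_lx : toZC p u (lx p u) = 1 := by rw [lx, toZC_of, toC_gx, map_one]

lemma lam_induction {P : Lam p u → Prop} (hof : ∀ g, P (MonoidAlgebra.of ℤ (G p u) g))
    (hadd : ∀ a b, P a → P b → P (a + b)) (hsmul : ∀ (n : ℤ) a, P a → P (n • a)) (a : Lam p u) :
    P a :=
  MonoidAlgebra.induction_on a hof hadd hsmul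

/-- The subgroup `⟨x⟩` is normal. Together with `exists_lx_sub_one_mul` this makes `(x - 1)Λ = Λ(x -
1)` a two-sided ideal. -/
lemma exists_mul_lx_sub_one [Fact p.Prime] (a : Lam p u) :
    ∃ b, a * (lx p u - 1) = (lx p u - 1) * b := by
  induction a using lam_induction with
  | hof g =>
    obtain ⟨c, hc⟩ := exists_mul_gx p u g
    obtain ⟨d, hd⟩ := sub_one_dvd_pow_sub_one (lx p u) c
    refine ⟨d * MonoidAlgebra.of ℤ (G p u) g, ?_⟩
    rw [← mul_assoc, ← hd, mul_sub, sub_mul, lx, ← map_pow, ← map_mul, ← map_mul, hc, mul_one,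
      one_mul]
  | hadd a b ha hb =>
    obtain ⟨a', ha⟩ := ha
    obtain ⟨b', hb⟩ := hb
    exact ⟨a' + b', by rw [add_mul, mul_add, ha, hb]⟩
  | hsmul n a ha =>
    obtain ⟨a', ha⟩ := ha
    exact ⟨n • a', by rw [smul_mul_assoc, mul_smul_comm, ha]⟩

lemma exists_lx_sub_one_mul [Fact p.Prime] (a : Lam p u) :
    ∃ b, (lx p u - 1) * a = b * (lx p u - 1) := by
  induction a using lam_induction with
  | hof g =>
    obtain ⟨c, hc⟩ := exists_gx_mul p u g
    refine ⟨MonoidAlgebra.of ℤ (G p u) g * ∑ i ∈ Finset.range c, lx p u ^ i, ?_⟩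
    rw [mul_assoc, geom_sum_mul, mul_sub, sub_mul, lx, ← map_pow, ← map_mul, ← map_mul, hc,
      mul_one, one_mul]
  | hadd a b ha hb =>
    obtain ⟨a', ha⟩ := ha
    obtain ⟨b', hb⟩ := hb
    exact ⟨a' + b', by rw [add_mul, mul_add, ha, hb]⟩
  | hsmul n a ha =>
    obtain ⟨a', ha⟩ := ha
    exact ⟨n • a', by rw [smul_mul_assoc, mul_smul_comm, ha]⟩

lemma cy_pow_val [Fact p.Prime] (k : ℕ) :
    (Multiplicative.toAdd (cy p ^ k)).val = k % (p - 1) := by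
  rw [cy, ← ofAdd_nsmul, toAdd_ofAdd, nsmul_one, ZMod.val_natCast]

/-- The kernel of `Λ → ℤ[C_{p-1}]` is `(x - 1)Λ`. -/
lemma toZC_eq_zero [Fact p.Prime] (a : Lam p u) (ha : toZC p u a = 0) :
    ∃ b, a = (lx p u - 1) * b := by
  -- An additive section of the projection, with the powers of `y` as coset representatives. Every
  -- `a` is congruent to `s` of its image modulo `(x - 1)Λ`.
  let s : MonoidAlgebra ℤ (C p) → Lam p u :=
    MonoidAlgebra.mapDomain fun c => gy p u ^ (Multiplicative.toAdd c).val
  have hs : ∀ a b, s (a + b) = s a + s b := fun a b => MonoidAlgebra.mapDomain_add _ a b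
  let s' : MonoidAlgebra ℤ (C p) →+ Lam p u := AddMonoidHom.mk' s hs
  have key : ∀ a : Lam p u, ∃ b, a - s' (toZC p u a) = (lx p u - 1) * b := by
    intro a
    induction a using lam_induction with
    | hof g =>
      obtain ⟨a, k, rfl⟩ := exists_normal_form p u g
      have e : s' (toZC p u (MonoidAlgebra.of ℤ (G p u) (gx p u ^ a * gy p u ^ k))) =
          MonoidAlgebra.of ℤ (G p u) (gy p u ^ k) := by
        rw [toZC_of, map_mul (toC p u), map_pow (toC p u), map_pow (toC p u), toC_gx, toC_gy,
          one_pow, one_mul]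
        change s _ = _
        simp only [s]
        rw [MonoidAlgebra.of_apply, MonoidAlgebra.of_apply, MonoidAlgebra.mapDomain_single,
          cy_pow_val, gy_pow_mod]
      obtain ⟨d, hd⟩ := sub_one_dvd_pow_sub_one (lx p u) a
      refine ⟨d * MonoidAlgebra.of ℤ (G p u) (gy p u ^ k), ?_⟩
      rw [e, ← mul_assoc, ← hd, sub_mul, one_mul, map_mul, map_pow, lx]
    | hadd a b ha hb =>
      obtain ⟨a', ha⟩ := ha
      obtain ⟨b', hb⟩ := hb
      refine ⟨a' + b', ?_⟩
      rw [mul_add, ← ha, ← hb, map_add, map_add]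
      abel
    | hsmul n a ha =>
      obtain ⟨a', ha⟩ := ha
      refine ⟨n • a', ?_⟩
      rw [mul_smul_comm, ← ha, map_zsmul, map_zsmul, smul_sub]
  obtain ⟨b, hb⟩ := key a
  rw [ha, map_zero, sub_zero] at hb
  exact ⟨b, hb⟩

/-- The norm element `1 + y + ⋯ + y ^ (p - 2)` of `Λ`. -/
def normY : Lam p u := ∑ k ∈ Finset.range (p - 1), ly p u ^ k

lemma ly_pow : ly p u ^ (p - 1) = 1 := by rw [ly, ← map_pow, gy_pow, map_one]

lemma ly_sub_one_mul_normY : (ly p u - 1) * normY p u = 0 := by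
  rw [normY, mul_geom_sum, ly_pow, sub_self]

lemma normY_mul_ly_sub_one : normY p u * (ly p u - 1) = 0 := by
  rw [normY, geom_sum_mul, ly_pow, sub_self]

/-- The coefficients of `b` are invariant under translation by a generator, hence all equal. -/
lemma eq_zsmul_of_cy_sub_one_mul [Fact p.Prime] (b : MonoidAlgebra ℤ (C p))
    (hb : (MonoidAlgebra.of ℤ (C p) (cy p) - 1) * b = 0) :
    ∃ n : ℤ, b = n • ∑ k ∈ Finset.range (p - 1), MonoidAlgebra.of ℤ (C p) (cy p) ^ k := by
  have h1 : MonoidAlgebra.of ℤ (C p) (cy p) * b = b := by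
    rwa [sub_mul, one_mul, sub_eq_zero] at hb
  have h2 : ∀ c, b.coeff (cy p * c) = b.coeff c := by
    intro c
    have := congrArg (fun z => MonoidAlgebra.coeff z (cy p * c)) h1
    simp only [MonoidAlgebra.of_apply] at this
    rw [MonoidAlgebra.coeff_single_mul_apply] at this
    simpa using this.symm
  have h3 : ∀ k : ℕ, b.coeff (cy p ^ k) = b.coeff 1 := by
    intro k
    induction k with
    | zero => simp
    | succ k ih => rw [pow_succ', h2, ih]
  refine ⟨b.coeff 1, ?_⟩
  ext c
  obtain ⟨k, rfl⟩ := cy_generates p c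
  rw [h3]
  have hpos : 0 < p - 1 := one_le_pred p
  have hmod : cy p ^ k = cy p ^ (k % (p - 1)) := by
    conv_lhs => rw [← Nat.mod_add_div k (p - 1), pow_add, pow_mul, cy_pow, one_pow, mul_one]
  have e : ∀ i ∈ Finset.range (p - 1), (MonoidAlgebra.of ℤ (C p) (cy p) ^ i).coeff (cy p ^ k) =
      if i = k % (p - 1) then 1 else 0 := by
    intro i hi
    rw [← map_pow, MonoidAlgebra.of_apply, MonoidAlgebra.coeff_single, Finsupp.single_apply]
    congr 1
    rw [eq_iff_iff]
    constructor
    · intro h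
      have := congrArg (fun z => (Multiplicative.toAdd z).val) h
      simp only [cy_pow_val] at this
      rwa [Nat.mod_eq_of_lt (Finset.mem_range.1 hi)] at this
    · rintro rfl
      exact hmod.symm
  rw [MonoidAlgebra.coeff_smul_apply, MonoidAlgebra.coeff_sum, Finsupp.finsetSum_apply,
    Finset.sum_congr rfl e, Finset.sum_ite_eq', if_pos (Finset.mem_range.2 (Nat.mod_lt _ hpos))]
  simp

/-- The kernel of `[y - 1) → I(C_{p-1})` is `(y - 1)(x - 1)Λ`. -/
lemma yToAug_eq_zero_iff [Fact p.Prime] (a : yIdeal p u) :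
    yToAug p u a = 0 ↔ ∃ b, (a : Lam p u) = (ly p u - 1) * ((lx p u - 1) * b) := by
  have h0 : yToAug p u a = 0 ↔ toZC p u a = 0 := Subtype.ext_iff
  rw [h0]
  constructor
  · intro h
    obtain ⟨b, hb⟩ := (mem_yIdeal p u a).1 a.2
    rw [← hb, map_mul, toZC_gy] at h
    obtain ⟨n, hn⟩ := eq_zsmul_of_cy_sub_one_mul p _ h
    -- Subtracting a multiple of the norm does not change `(y - 1) * b`, and it moves `b` into the
    -- kernel `(x - 1)Λ`.
    have h1 : toZC p u (b - n • normY p u) = 0 := by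
      rw [map_sub, hn, map_zsmul, normY, map_sum]
      simp only [ly, map_pow, toZC_of, toC_gy]
      exact sub_self _
    obtain ⟨c, hc⟩ := toZC_eq_zero p u _ h1
    refine ⟨c, ?_⟩
    rw [← hc, mul_sub, mul_smul_comm, ly_sub_one_mul_normY, smul_zero, sub_zero, ← hb, ly]
  · rintro ⟨b, hb⟩
    rw [hb, map_mul, map_mul, map_sub _ (lx p u), toZC_lx, map_one, sub_self, zero_mul, mul_zero]

end GroupRing

/-! ### The homomorphism `Λ → 𝒯_{p-1}(ℤ, p)`: characters -/

section Generator

variable (p : ℕ) [Fact p.Prime] (u : (ZMod p)ˣ) (hu : orderOf u = p - 1)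
include hu

lemma exists_pow_eq (v : (ZMod p)ˣ) : ∃ k < p - 1, u ^ k = v := by
  have hc : Nat.card (ZMod p)ˣ = p - 1 := by
    rw [Nat.card_eq_fintype_card, ZMod.card_units_eq_totient, Nat.totient_prime Fact.out]
  have h : v ∈ Subgroup.zpowers u := by
    rw [(Subgroup.card_eq_iff_eq_top _).1 ((Nat.card_zpowers u).trans (hu.trans hc.symm))]
    trivial
  rw [← mem_powers_iff_mem_zpowers, mem_powers_iff_mem_range_orderOf, hu] at h
  obtain ⟨k, hk, hkv⟩ := Finset.mem_image.1 h
  exact ⟨k, Finset.mem_range.1 hk, hkv⟩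

lemma pow_injOn : Set.InjOn (fun k : ℕ => u ^ k) (Set.Iio (p - 1)) := by
  rw [← hu]
  exact pow_injOn_Iio_orderOf

/-- As `u` generates the units, `n * u ^ k` runs once through the nonzero residues. This evaluates
every sum over powers of `y` below. -/
lemma sum_mul_pow {M : Type*} [AddCommMonoid M] (F : ZMod p → M) (n : ZMod p) (hn : n ≠ 0) :
    ∑ k ∈ Finset.range (p - 1), F (n * (u ^ k : (ZMod p)ˣ)) = ∑ a ∈ Finset.univ.erase 0, F a := by
  refine Finset.sum_nbij (fun k => n * ((u ^ k : (ZMod p)ˣ) : ZMod p)) ?_ ?_ ?_ ?_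
  · intro k _
    rw [Finset.mem_erase]
    exact ⟨mul_ne_zero hn (Units.ne_zero _), Finset.mem_univ _⟩
  · intro i hi j hj h
    exact pow_injOn p u hu (by simpa using hi) (by simpa using hj)
      (Units.ext (mul_left_cancel₀ hn h))
  · intro a ha
    obtain ⟨k, hk, hk'⟩ := exists_pow_eq p u hu
      (Units.mk0 (n⁻¹ * a) (mul_ne_zero (inv_ne_zero hn) (by simpa using ha)))
    refine ⟨k, by simpa using hk, ?_⟩
    simp only [hk', Units.val_mk0]
    rw [mul_inv_cancel_left₀ hn]
  · intro k _
    rfl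

end Generator

section Character

variable (p : ℕ) [Fact p.Prime] (u : (ZMod p)ˣ)

lemma latticeRep_of (g : G p u) :
    latticeRep p u (MonoidAlgebra.of ℤ (G p u) g) = (groupRep p u g : Tri p) := by
  simp [latticeRep]

lemma groupRep_gx : (groupRep p u (gx p u) : Tri p) = matX p := by
  simp [groupRep, gx, unitX]

lemma groupRep_gy : (groupRep p u (gy p u) : Tri p) = matY p u := by
  simp [groupRep, gy, unitY]

lemma latticeRep_lx : latticeRep p u (lx p u) = matX p := by
  rw [lx, latticeRep_of, groupRep_gx]

lemma latticeRep_ly : latticeRep p u (ly p u) = matY p u := by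
  rw [ly, latticeRep_of, groupRep_gy]

/-- The character of the representation `Λ → 𝒯_{p-1}(ℤ, p)`. -/
def latticeTrace : Lam p u →+ ℤ :=
  (Matrix.traceAddMonoidHom (Idx p) ℤ).comp
    ((Tri p).subtype.comp (latticeRep p u) : Lam p u →+* Matrix (Idx p) (Idx p) ℤ).toAddMonoidHom

lemma latticeTrace_apply (a : Lam p u) :
    latticeTrace p u a = Matrix.trace (latticeRep p u a).1 := rfl

lemma latticeTrace_mul_comm (a b : Lam p u) :
    latticeTrace p u (a * b) = latticeTrace p u (b * a) := by
  rw [latticeTrace_apply, latticeTrace_apply, map_mul, map_mul]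
  exact Matrix.trace_mul_comm _ _

/-- The character value at a group element. -/
def chi (g : G p u) : ℤ := latticeTrace p u (MonoidAlgebra.of ℤ (G p u) g)

lemma chi_mul_comm (g h : G p u) : chi p u (g * h) = chi p u (h * g) := by
  rw [chi, map_mul, latticeTrace_mul_comm, ← map_mul, chi]

lemma chi_one : chi p u 1 = p - 1 := by
  rw [chi, map_one, latticeTrace_apply, map_one]
  change Matrix.trace (1 : Matrix (Idx p) (Idx p) ℤ) = _
  rw [Matrix.trace_one, Fintype.card_coe, Nat.card_Icc]
  have := one_le_pred p
  omega

lemma sum_matX_pow : ∑ i ∈ Finset.range p, matX p ^ i = 0 := by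
  apply Subtype.ext
  rw [AddSubmonoidClass.coe_finsetSum]
  simp only [matX_pow_val]
  rw [← map_sum]
  have : ∑ i ∈ Finset.range p, LinearMap.mulLeft ℤ (zeta p ^ i) = 0 := by
    ext a
    rw [LinearMap.sum_apply]
    simp only [LinearMap.mulLeft_apply, ← Finset.sum_mul, sum_zeta, zero_mul, LinearMap.zero_apply]
  rw [this, map_zero]
  rfl

lemma latticeRep_sum_lx : latticeRep p u (∑ i ∈ Finset.range p, lx p u ^ i) = 0 := by
  rw [map_sum]
  simp only [map_pow, latticeRep_lx, sum_matX_pow]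

lemma sum_chi (g : G p u) : ∑ i ∈ Finset.range p, chi p u (gx p u ^ i * g) = 0 := by
  have : ∑ i ∈ Finset.range p, chi p u (gx p u ^ i * g) =
      latticeTrace p u ((∑ i ∈ Finset.range p, lx p u ^ i) * MonoidAlgebra.of ℤ _ g) := by
    rw [Finset.sum_mul, map_sum]
    simp only [chi, map_mul, map_pow, lx]
  rw [this, latticeTrace_apply, map_mul, latticeRep_sum_lx, zero_mul]
  exact Matrix.trace_zero _ _

/-- All `x ^ c * y ^ k` are conjugate under `⟨x⟩`, and their characters add up to `0` because `1 + X
+ ⋯ + X ^ (p - 1) = 0`. -/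
lemma chi_gx_pow_mul_gy_pow (k : ℕ) (hk : u ^ k ≠ 1) (a : ℕ) :
    chi p u (gx p u ^ a * gy p u ^ k) = 0 := by
  have hk' : 1 - ((u ^ k : (ZMod p)ˣ) : ZMod p) ≠ 0 := by
    intro h
    exact hk (Units.ext (sub_eq_zero.1 h).symm)
  have h1 : ∀ c : ℕ, chi p u (gx p u ^ c * gy p u ^ k) = chi p u (gy p u ^ k) := by
    intro c
    -- Conjugating `y ^ k` by `x ^ t` gives `x ^ (t * (1 - u ^ k)) * y ^ k`.
    set t : ZMod p := c / (1 - ((u ^ k : (ZMod p)ˣ) : ZMod p)) with ht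
    have e : gx p u ^ t.val * (gy p u ^ k * gx p u ^ (-t).val) = gx p u ^ c * gy p u ^ k := by
      rw [gy_pow_mul_gx_pow, ← mul_assoc, ← pow_add]
      congr 1
      apply gx_pow_congr
      rw [Nat.cast_add, Nat.cast_mul, ZMod.natCast_zmod_val, ZMod.natCast_zmod_val,
        ZMod.natCast_zmod_val]
      have : t * (1 - ((u ^ k : (ZMod p)ˣ) : ZMod p)) = c := div_mul_cancel₀ _ hk'
      linear_combination this
    rw [← e, chi_mul_comm, mul_assoc, ← pow_add]
    have : gx p u ^ ((-t).val + t.val) = gx p u ^ 0 := by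
      apply gx_pow_congr
      simp
    rw [this, pow_zero, mul_one]
  have h2 := sum_chi p u (gy p u ^ k)
  simp only [h1, Finset.sum_const, Finset.card_range, nsmul_eq_mul] at h2
  rw [h1]
  exact (mul_eq_zero.1 h2).resolve_left (by exact_mod_cast (Fact.out : p.Prime).ne_zero)

variable (hu : orderOf u = p - 1)
include hu

/-- The nontrivial powers of `x` are all conjugate under `⟨y⟩`, so the vanishing sum over `⟨x⟩`
reads `(p - 1) + (p - 1) * χ(x) = 0`. -/
lemma chi_gx_pow (a : ℕ) (ha : (a : ZMod p) ≠ 0) : chi p u (gx p u ^ a) = -1 := by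
  have h1 : ∀ c : ℕ, (c : ZMod p) ≠ 0 → chi p u (gx p u ^ c) = chi p u (gx p u) := by
    intro c hc
    obtain ⟨k, -, hk⟩ := exists_pow_eq p u hu (Units.mk0 _ hc)
    have e : gx p u ^ c * gy p u ^ k = gy p u ^ k * gx p u ^ 1 := by
      rw [gy_pow_mul_gx_pow]
      congr 1
      apply gx_pow_congr
      simp [hk]
    have : gx p u ^ c = gy p u ^ k * (gx p u * (gy p u ^ k)⁻¹) := by
      rw [← mul_assoc, eq_mul_inv_iff_mul_eq, e, pow_one]
    rw [this, chi_mul_comm, inv_mul_cancel_right]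
  have h2 := sum_chi p u 1
  have hp := (Fact.out : p.Prime).two_le
  obtain ⟨n, hn⟩ : ∃ n, p = n + 1 := ⟨p - 1, by omega⟩
  have hr : Finset.range p = insert 0 (Finset.Ico 1 p) := by
    ext i
    simp
    omega
  rw [hr, Finset.sum_insert (by simp), Finset.sum_congr rfl (g := fun _ => chi p u (gx p u)),
    Finset.sum_const, Nat.card_Ico, pow_zero, one_mul, chi_one, nsmul_eq_mul,
    Nat.cast_sub (by omega), Nat.cast_one] at h2
  · rw [h1 a ha]
    have h3 : ((p : ℤ) - 1) * (1 + chi p u (gx p u)) = 0 := by linear_combination h2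
    have h4 : (p : ℤ) - 1 ≠ 0 := by omega
    have := (mul_eq_zero.1 h3).resolve_left h4
    omega
  · intro i hi
    rw [mul_one]
    apply h1
    rw [Ne, ZMod.natCast_eq_zero_iff]
    intro h
    have := Nat.le_of_dvd (by simp at hi; omega) h
    simp at hi
    omega

/-- A trace formula, checked on `x ^ a * y ^ k`: the identity gives `p = 1 + (p - 1)`, a nontrivial
power of `x` gives `0 = 1 - 1`, and all other elements give `0 = 0 + 0`. It recovers a coefficient
from the two images of `a`. -/
lemma p_mul_coeff_one (a : Lam p u) :
    p * a.coeff 1 = (toZC p u a).coeff 1 + latticeTrace p u a := by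
  classical
  induction a using lam_induction with
  | hof g =>
    obtain ⟨a, k, rfl⟩ := exists_normal_form p u g
    rw [toZC_of]
    change _ = _ + chi p u _
    rw [MonoidAlgebra.of_apply, MonoidAlgebra.of_apply, MonoidAlgebra.coeff_single,
      MonoidAlgebra.coeff_single, Finsupp.single_apply, Finsupp.single_apply, map_mul, map_pow,
      map_pow, toC_gx, toC_gy, one_pow, one_mul]
    have hk : u ^ k = 1 ↔ cy p ^ k = 1 := by
      rw [← orderOf_dvd_iff_pow_eq_one, hu, cy, ← ofAdd_nsmul, ofAdd_eq_one, nsmul_one,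
        ZMod.natCast_eq_zero_iff]
    by_cases h : u ^ k = 1
    · have hy : gy p u ^ k = 1 := by
        rw [← orderOf_dvd_iff_pow_eq_one, hu] at h
        obtain ⟨c, rfl⟩ := h
        rw [pow_mul, gy_pow, one_pow]
      simp only [hy, mul_one, if_pos (hk.1 h)]
      by_cases ha : (a : ZMod p) = 0
      · have : gx p u ^ a = 1 := by
          rw [← pow_zero (gx p u)]
          exact gx_pow_congr p u (by simpa using ha)
        rw [this, if_pos rfl, chi_one]
        ring
      · rw [chi_gx_pow p u hu a ha, if_neg]
        · ring
        · intro h1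
          have h2 := chi_gx_pow p u hu a ha
          rw [h1, chi_one] at h2
          have := (Fact.out : p.Prime).two_le
          omega
    · rw [chi_gx_pow_mul_gy_pow p u k h, if_neg, if_neg]
      · ring
      · rwa [← hk]
      · intro h1
        have h2 := congrArg (toC p u) h1
        rw [map_mul, map_pow, map_pow, toC_gx, toC_gy, one_pow, one_mul, map_one] at h2
        exact h (hk.2 h2)
  | hadd a b ha hb =>
    rw [map_add, map_add, MonoidAlgebra.coeff_add, MonoidAlgebra.coeff_add, Finsupp.add_apply,
      Finsupp.add_apply]
    linear_combination ha + hb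
  | hsmul n a ha =>
    rw [map_zsmul, map_zsmul, MonoidAlgebra.coeff_smul_apply, MonoidAlgebra.coeff_smul_apply]
    simp only [smul_eq_mul]
    linear_combination n * ha

/-- The homomorphism `Λ → ℤ[C_{p-1}] × 𝒯_{p-1}(ℤ, p)` is injective. -/
lemma eq_zero_of_latticeRep_eq_zero (a : Lam p u) (h1 : toZC p u a = 0)
    (h2 : latticeRep p u a = 0) : a = 0 := by
  ext g
  -- Translation by `g⁻¹` moves the coefficient at `g` to the identity.
  have h := p_mul_coeff_one p u hu (a * MonoidAlgebra.of ℤ (G p u) g⁻¹)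
  rw [map_mul, h1, zero_mul, latticeTrace_apply, map_mul, h2, zero_mul, MonoidAlgebra.of_apply]
    at h
  have h3 := MonoidAlgebra.coeff_mul_single_apply a (1 : ℤ) g⁻¹ 1
  rw [inv_inv, one_mul, mul_one] at h3
  rw [h3] at h
  have hp : p ≠ 0 := (Fact.out : p.Prime).ne_zero
  have h4 : Matrix.trace ((0 : Tri p) : Matrix (Idx p) (Idx p) ℤ) = 0 := Matrix.trace_zero _ _
  rw [h4] at h
  simpa [hp] using h

end Character

/-! ### The homomorphism `Λ → 𝒯_{p-1}(ℤ, p)`: surjectivity -/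

section Surjective

variable (p : ℕ) [Fact p.Prime] (u : (ZMod p)ˣ)

/-- The action of `Λ` on `ℤ[ζ]`. -/
def lamAct : Lam p u →+* Module.End ℤ (Zeta p) :=
  ((LinearMap.toMatrixAlgEquiv (zetaBasis p)).symm.toRingEquiv.toRingHom.comp
    (Tri p).subtype).comp (latticeRep p u)

lemma toMatrix_lamAct (a : Lam p u) :
    LinearMap.toMatrix (zetaBasis p) (zetaBasis p) (lamAct p u a) = (latticeRep p u a).1 :=
  (LinearMap.toMatrixAlgEquiv (zetaBasis p)).apply_symm_apply _

lemma lamAct_eq {a : Lam p u} {f : Module.End ℤ (Zeta p)}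
    (h : (latticeRep p u a).1 = LinearMap.toMatrix (zetaBasis p) (zetaBasis p) f) :
    lamAct p u a = f := by
  apply (LinearMap.toMatrix (zetaBasis p) (zetaBasis p)).injective
  rw [toMatrix_lamAct, h]

lemma lamAct_lx : lamAct p u (lx p u) = LinearMap.mulLeft ℤ (zeta p) :=
  lamAct_eq p u (by rw [latticeRep_lx]; rfl)

lemma lamAct_ly : lamAct p u (ly p u) = (gal p u).toLinearMap :=
  lamAct_eq p u (by rw [latticeRep_ly]; rfl)

lemma lamAct_ly_pow_apply (k n : ℕ) :
    lamAct p u (ly p u ^ k) (zeta p ^ n) =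
      zeta p ^ (((n : ZMod p) * (u ^ k : (ZMod p)ˣ)).val) := by
  have h : ∀ k, lamAct p u (ly p u ^ k) = (gal p (u ^ k)).toLinearMap := by
    intro k
    induction k with
    | zero =>
      rw [pow_zero, pow_zero, map_one]
      exact LinearMap.ext fun a => (gal_one p a).symm
    | succ k ih =>
      rw [pow_succ, pow_succ, map_mul, ih, lamAct_ly]
      exact LinearMap.ext fun a => (gal_mul p _ _ a).symm
  rw [h, AlgHom.toLinearMap_apply, map_pow, gal_zeta, ← pow_mul, ZMod.val_mul, zeta_pow_mod,
    ZMod.val_natCast, pow_mul', pow_mul _ (n % p), zeta_pow_mod]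

lemma sum_zeta_val : ∑ a : ZMod p, zeta p ^ a.val = 0 := by
  suffices key : ∑ i ∈ Finset.range p, zeta p ^ i = ∑ a : ZMod p, zeta p ^ a.val by
    rw [← key, sum_zeta]
  refine Finset.sum_bij' (fun i _ => (i : ZMod p)) (fun a _ => a.val) ?_ ?_ ?_ ?_ ?_
  · intro i _
    exact Finset.mem_univ _
  · intro a _
    exact Finset.mem_range.2 a.val_lt
  · intro i hi
    exact ZMod.val_cast_of_lt (Finset.mem_range.1 hi)
  · intro a _
    exact ZMod.natCast_zmod_val a
  · intro i hi
    rw [ZMod.val_cast_of_lt (Finset.mem_range.1 hi)]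

lemma span_zeta_pow : Submodule.span ℤ (Set.range fun n : ℕ => zeta p ^ n) = ⊤ := by
  have h1 : ∀ a ∈ Submodule.span ℤ (Set.range fun n : ℕ => zeta p ^ n),
      pi' p * a ∈ Submodule.span ℤ (Set.range fun n : ℕ => zeta p ^ n) := by
    intro a ha
    induction ha using Submodule.span_induction with
    | mem a ha =>
      obtain ⟨n, rfl⟩ := ha
      have : pi' p * zeta p ^ n = zeta p ^ (n + 1) - zeta p ^ n := by
        rw [pow_succ', zeta]
        ring
      simp only [this]
      exact Submodule.sub_mem _ (Submodule.subset_span ⟨n + 1, rfl⟩)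
        (Submodule.subset_span ⟨n, rfl⟩)
    | zero => simp
    | add a b _ _ ha hb =>
      rw [mul_add]
      exact Submodule.add_mem _ ha hb
    | smul n a _ ha =>
      rw [mul_smul_comm]
      exact Submodule.smul_mem _ _ ha
  have h2 : ∀ n : ℕ, pi' p ^ n ∈ Submodule.span ℤ (Set.range fun n : ℕ => zeta p ^ n) := by
    intro n
    induction n with
    | zero => exact Submodule.subset_span ⟨0, by simp⟩
    | succ n ih =>
      rw [pow_succ']
      exact h1 _ ih
  rw [eq_top_iff, ← (zetaBasis p).span_eq, Submodule.span_le]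
  rintro _ ⟨i, rfl⟩
  rw [zetaBasis_apply]
  exact h2 _

lemma exists_lamAct_mulLeft (c : Zeta p) : ∃ a, lamAct p u a = LinearMap.mulLeft ℤ c := by
  have hc : c ∈ Submodule.span ℤ (Set.range fun n : ℕ => zeta p ^ n) := by
    rw [span_zeta_pow]
    trivial
  induction hc using Submodule.span_induction with
  | mem a ha =>
    obtain ⟨n, rfl⟩ := ha
    exact ⟨lx p u ^ n, by rw [map_pow, lamAct_lx, LinearMap.pow_mulLeft]⟩
  | zero => exact ⟨0, by rw [map_zero, LinearMap.mulLeft_zero_eq_zero]⟩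
  | add a b _ _ ha hb =>
    obtain ⟨a', ha⟩ := ha
    obtain ⟨b', hb⟩ := hb
    refine ⟨a' + b', ?_⟩
    rw [map_add, ha, hb]
    ext z
    simp [add_mul]
  | smul n a _ ha =>
    obtain ⟨a', ha⟩ := ha
    refine ⟨n • a', ?_⟩
    rw [map_zsmul, ha]
    ext z
    simp

section Tame

variable (hu : orderOf u = p - 1)
include hu

/-- The norm sums the Galois conjugates of `ζ ^ n`. -/
lemma lamAct_normY (n : ℕ) :
    lamAct p u (normY p u) (zeta p ^ n) = if (n : ZMod p) = 0 then (p : Zeta p) - 1 else -1 := by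
  rw [normY, map_sum, LinearMap.sum_apply]
  simp only [lamAct_ly_pow_apply]
  split_ifs with h
  · rw [h]
    simp only [zero_mul, ZMod.val_zero, pow_zero, Finset.sum_const, Finset.card_range,
      nsmul_eq_mul, mul_one]
    rw [Nat.cast_sub ((one_le_pred p).trans (Nat.sub_le _ _)), Nat.cast_one]
  · rw [sum_mul_pow p u hu (fun a => zeta p ^ a.val) _ h]
    have h1 := Finset.add_sum_erase Finset.univ (fun a : ZMod p => zeta p ^ a.val)
      (Finset.mem_univ 0)
    rw [sum_zeta_val, ZMod.val_zero, pow_zero] at h1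
    exact (neg_eq_of_add_eq_zero_right h1).symm

/-- Take `∑ f(ζ^i) * N * x^(-i)`, with `N` the norm element. By `lamAct_normY` its `i`-th term sends
`ζ^j` to `(p * δ - 1) * f(ζ^i)`, where `δ` is `1` if `i ≡ j` modulo `p` and `0` otherwise. The terms
with `-1` add up to `-f(∑ ζ^i) = 0`. -/
lemma exists_lamAct_smul (f : Module.End ℤ (Zeta p)) : ∃ a, lamAct p u a = (p : ℤ) • f := by
  choose b hb using exists_lamAct_mulLeft p u
  refine ⟨∑ i ∈ Finset.range p, b (f (zeta p ^ i)) * normY p u * lx p u ^ (p - i), ?_⟩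
  refine LinearMap.ext_on (span_zeta_pow p) ?_
  rintro _ ⟨j, rfl⟩
  have hp : 0 < p := (Fact.out : p.Prime).pos
  have e : ∀ i ∈ Finset.range p,
      lamAct p u (b (f (zeta p ^ i)) * normY p u * lx p u ^ (p - i)) (zeta p ^ j) =
        (if i = j % p then p * f (zeta p ^ i) else 0) - f (zeta p ^ i) := by
    intro i hi
    have hi' := Finset.mem_range.1 hi
    rw [map_mul, map_mul, map_pow (lamAct p u), hb, lamAct_lx, LinearMap.pow_mulLeft, Module.End.mul_apply,
      Module.End.mul_apply, LinearMap.mulLeft_apply, LinearMap.mulLeft_apply, ← pow_add,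
      lamAct_normY p u hu]
    have hc : ((p - i + j : ℕ) : ZMod p) = 0 ↔ i = j % p := by
      rw [Nat.cast_add, Nat.cast_sub hi'.le, CharP.cast_eq_zero, zero_sub, neg_add_eq_zero,
        ZMod.natCast_eq_natCast_iff', Nat.mod_eq_of_lt hi']
    rw [if_congr hc rfl rfl]
    split_ifs <;> ring
  simp only [map_sum, LinearMap.sum_apply]
  rw [Finset.sum_congr rfl e, Finset.sum_sub_distrib, Finset.sum_ite_eq',
    if_pos (Finset.mem_range.2 (Nat.mod_lt _ hp)), zeta_pow_mod, ← map_sum, sum_zeta, map_zero,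
    sub_zero, LinearMap.smul_apply, zsmul_eq_mul]
  simp

lemma exists_latticeRep_smul (A : Tri p) : ∃ a, latticeRep p u a = (p : ℤ) • A := by
  obtain ⟨a, ha⟩ := exists_lamAct_smul p u hu
    ((LinearMap.toMatrix (zetaBasis p) (zetaBasis p)).symm A.1)
  refine ⟨a, Subtype.ext ?_⟩
  rw [← toMatrix_lamAct, ha, map_smul, LinearEquiv.apply_symm_apply]
  rfl

end Tame

/-- The diagonal entries modulo `p`. -/
def triDiag : Tri p →+* (Idx p → ZMod p) where
  toFun A i := (A.1 i i : ZMod p)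
  map_zero' := by
    funext i
    exact Int.cast_zero
  map_one' := by
    funext i
    change (((1 : Matrix (Idx p) (Idx p) ℤ) i i : ℤ) : ZMod p) = 1
    rw [Matrix.one_apply_eq, Int.cast_one]
  map_add' A B := by
    funext i
    exact Int.cast_add _ _
  map_mul' A B := by
    funext i
    change (((A.1 * B.1) i i : ℤ) : ZMod p) = (A.1 i i : ZMod p) * (B.1 i i : ZMod p)
    rw [Matrix.mul_apply, Int.cast_sum, Finset.sum_eq_single i, Int.cast_mul]
    · intro k _ hk
      rw [ZMod.intCast_zmod_eq_zero_iff_dvd]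
      rcases lt_or_gt_of_ne hk with h | h
      · exact (A.2 i k h).mul_right _
      · exact (B.2 k i h).mul_left _
    · simp

lemma triDiag_apply (A : Tri p) (i : Idx p) : triDiag p A i = (A.1 i i : ZMod p) := rfl

/-- The automorphism sends `π` to `mπ` modulo `π²`, hence `π ^ e` to `m ^ e * π ^ e` modulo `π ^ (e
+ 1)`; at index `i` the exponent is `e = p - 1 - i`. -/
lemma triDiag_matY (i : Idx p) :
    triDiag p (matY p u) i = ((u ^ (p - 1 - (i : ℕ)) : (ZMod p)ˣ) : ZMod p) := by
  set e := p - 1 - (i : ℕ) with he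
  rw [triDiag_apply]
  change ((LinearMap.toMatrix _ _ (gal p u).toLinearMap i i : ℤ) : ZMod p) = _
  rw [LinearMap.toMatrix_apply, AlgHom.toLinearMap_apply, zetaBasis_apply, ← he, map_pow, gal_pi]
  set m := (u : ZMod p).val with hm
  obtain ⟨s, hs⟩ : ∃ s, ∑ j ∈ Finset.range m, zeta p ^ j = m + pi' p * s := by
    have : ∀ j : ℕ, pi' p ∣ zeta p ^ j - 1 := by
      intro j
      have h := sub_one_dvd_pow_sub_one (zeta p) j
      rwa [zeta, add_sub_cancel_right, ← zeta] at h
    obtain ⟨s, hs⟩ := Finset.dvd_sum (s := Finset.range m) fun j _ => this j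
    refine ⟨s, ?_⟩
    rw [← hs, Finset.sum_sub_distrib]
    simp
  have h1 : zeta p ^ m - 1 = pi' p * (m + pi' p * s) := by
    rw [← hs, ← mul_geom_sum, zeta, add_sub_cancel_right]
  obtain ⟨t, ht⟩ : ∃ t, (zeta p ^ m - 1) ^ e = (m ^ e : ℕ) • pi' p ^ e + pi' p ^ (e + 1) * t := by
    obtain ⟨t, ht⟩ := sub_dvd_pow_sub_pow (m + pi' p * s) (m : Zeta p) e
    rw [add_sub_cancel_left, sub_eq_iff_eq_add] at ht
    refine ⟨s * t, ?_⟩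
    rw [h1, mul_pow, ht, nsmul_eq_mul]
    push_cast
    ring
  have hb : pi' p ^ e = zetaBasis p i := by rw [zetaBasis_apply]
  have hd := dvd_repr p (e + 1) t i (by omega)
  rw [ht, map_add, Finsupp.add_apply, Int.cast_add,
    (ZMod.intCast_zmod_eq_zero_iff_dvd _ p).2 hd, add_zero, hb, map_nsmul, Module.Basis.repr_self,
    Finsupp.smul_apply, Finsupp.single_eq_same, nsmul_eq_mul, mul_one]
  simp [hm]

/-- The kernel of the reduction to the diagonal is `𝒯(X - 1)`. -/
lemma exists_mul_matX_sub_one (A : Tri p) (hA : triDiag p A = 0) :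
    ∃ W : Tri p, A = W * (matX p - 1) := by
  have h1 : ∀ i : Idx p, ∃ w ∈ Row p i, Matrix.vecMul w ((matX p).1 - 1) = A.1 i := by
    intro i
    -- A diagonal divisible by `p` puts row `i` into `R(i + 1) = R(i)(X - 1)`.
    refine exists_vecMul_matX_sub_one p i i.2 _ fun j hj => ?_
    rcases Nat.lt_or_ge j i with h | h
    · exact A.2 i j h
    · have : j = i := Subtype.ext (by omega)
      rw [this, ← ZMod.intCast_zmod_eq_zero_iff_dvd]
      exact congrFun hA i
  choose w hw hwA using h1
  refine ⟨⟨Matrix.of w, fun i j h => hw i j h⟩, Subtype.ext ?_⟩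
  ext i j
  rw [← hwA]
  rfl

lemma exists_matX_sub_one_pow : ∃ B : Tri p, (matX p - 1) ^ (p - 1) = (p : ℤ) • B := by
  obtain ⟨c, hc⟩ := p_dvd_pi_pow p
  refine ⟨⟨LinearMap.toMatrix (zetaBasis p) (zetaBasis p) (LinearMap.mulLeft ℤ c),
    toMatrix_mem p _ fun k => dvd_mul_left _ _⟩, Subtype.ext ?_⟩
  change ((matX p).1 - 1) ^ (p - 1) = (p : ℤ) • LinearMap.toMatrix _ _ _
  rw [matX_sub_one, LinearMap.toMatrix_pow, LinearMap.pow_mulLeft, hc, ← map_smul]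
  congr 1
  ext z
  simp

section Tame

variable (hu : orderOf u = p - 1)
include hu

/-- The diagonal entries of `Y` modulo `p` are distinct, since `u` has order `p - 1`. Lagrange
interpolation therefore realises any diagonal modulo `p` by a polynomial in `y`. -/
lemma exists_eq_latticeRep_add (A : Tri p) :
    ∃ a W, A = latticeRep p u a + W * (matX p - 1) := by
  let v : Idx p → ZMod p := fun i => ((u ^ (p - 1 - (i : ℕ)) : (ZMod p)ˣ) : ZMod p)
  have hv : Set.InjOn v (Finset.univ : Finset (Idx p)) := by
    intro i _ j _ h
    have hi := Finset.mem_Icc.1 i.2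
    have hj := Finset.mem_Icc.1 j.2
    have := pow_injOn p u hu (show p - 1 - (i : ℕ) < p - 1 by omega)
      (show p - 1 - (j : ℕ) < p - 1 by omega) (Units.ext h)
    exact Subtype.ext (by omega)
  obtain ⟨Q, hQ⟩ := Polynomial.map_surjective (Int.castRingHom (ZMod p)) ZMod.intCast_surjective
    (Lagrange.interpolate Finset.univ v (triDiag p A))
  have h1 : triDiag p (A - latticeRep p u (Polynomial.aeval (ly p u) Q)) = 0 := by
    rw [map_sub, sub_eq_zero]
    funext i
    have h2 : triDiag p (latticeRep p u (Polynomial.aeval (ly p u) Q)) i =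
        ((Pi.evalRingHom (fun _ => ZMod p) i).comp ((triDiag p).comp (latticeRep p u)))
          (Polynomial.aeval (ly p u) Q) := rfl
    rw [h2, Polynomial.aeval_def, Polynomial.hom_eval₂]
    have h3 : ((Pi.evalRingHom (fun _ => ZMod p) i).comp ((triDiag p).comp (latticeRep p u))).comp
        (algebraMap ℤ (Lam p u)) = Int.castRingHom (ZMod p) := RingHom.ext_int _ _
    have h4 : ((Pi.evalRingHom (fun _ => ZMod p) i).comp ((triDiag p).comp (latticeRep p u)))
        (ly p u) = v i := by
      change triDiag p (latticeRep p u (ly p u)) i = v i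
      rw [latticeRep_ly, triDiag_matY]
    rw [h3, h4, ← Polynomial.eval_map, hQ,
      Lagrange.eval_interpolate_at_node _ hv (Finset.mem_univ i)]
  obtain ⟨W, hW⟩ := exists_mul_matX_sub_one p _ h1
  exact ⟨_, W, (sub_eq_iff_eq_add'.1 hW)⟩

/-- The homomorphism `Λ → 𝒯_{p-1}(ℤ, p)` is surjective. -/
lemma latticeRep_surjective : Function.Surjective (latticeRep p u) := by
  -- Successive approximation in powers of `X - 1`. It stops at `n = p - 1`, where the remainder
  -- lies in `p𝒯`, which is contained in the image.
  have h : ∀ (n : ℕ) (A : Tri p), ∃ a W, A = latticeRep p u a + W * (matX p - 1) ^ n := by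
    intro n
    induction n with
    | zero => exact fun A => ⟨0, A, by simp⟩
    | succ n ih =>
      intro A
      obtain ⟨a, W, rfl⟩ := ih A
      obtain ⟨b, V, rfl⟩ := exists_eq_latticeRep_add p u hu W
      refine ⟨a + b * (lx p u - 1) ^ n, V, ?_⟩
      rw [map_add, map_mul, map_pow, map_sub, map_one, latticeRep_lx, add_mul, pow_succ', mul_assoc,
        add_assoc]
  intro A
  obtain ⟨a, W, rfl⟩ := h (p - 1) A
  obtain ⟨B, hB⟩ := exists_matX_sub_one_pow p
  obtain ⟨b, hb⟩ := exists_latticeRep_smul p u hu (W * B)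
  exact ⟨a + b, by rw [map_add, hb, hB, mul_smul_comm]⟩

end Tame

end Surjective

/-! ### The injection `R(1̂) → [y - 1)` -/

section Iota

lemma pred_mem_idx (p : ℕ) (i : ↥((Finset.Icc 1 (p - 1)).erase 1)) :
    (i : ℕ) - 1 ∈ Finset.Icc 1 (p - 1) := by
  have h := Finset.mem_erase.1 i.2
  have h' := Finset.mem_Icc.1 h.2
  exact Finset.mem_Icc.2 (by have := h.1; omega)

variable (p : ℕ) [Fact p.Prime] (u : (ZMod p)ˣ)

lemma zetaBasis_last : zetaBasis p ⟨p - 1, last_mem_idx p⟩ = 1 := by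
  rw [zetaBasis_apply, Nat.sub_self, pow_zero]

lemma matY_apply_last (i : Idx p) :
    (matY p u).1 i ⟨p - 1, last_mem_idx p⟩ = if i = ⟨p - 1, last_mem_idx p⟩ then 1 else 0 := by
  change LinearMap.toMatrix _ _ (gal p u).toLinearMap _ _ = _
  rw [LinearMap.toMatrix_apply, zetaBasis_last, AlgHom.toLinearMap_apply, map_one, ← zetaBasis_last,
    Module.Basis.repr_self, Finsupp.single_apply]
  simp only [eq_comm]

section Tame

variable (hu : orderOf u = p - 1)
include hu

/-- The norm element takes values in `ℤ · 1`, and `1` is the last basis vector. -/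
lemma repr_lamAct_normY (z : Zeta p) (i : Idx p) (hi : (i : ℕ) ≠ p - 1) :
    (zetaBasis p).repr (lamAct p u (normY p u) z) i = 0 := by
  have h1 : ∀ n : ℤ, (zetaBasis p).repr (n : Zeta p) i = 0 := by
    intro n
    have : (n : Zeta p) = n • zetaBasis p ⟨p - 1, last_mem_idx p⟩ := by
      rw [zetaBasis_last, zsmul_one]
    rw [this, map_smul, Module.Basis.repr_self, Finsupp.smul_apply, Finsupp.single_eq_of_ne,
      smul_zero]
    intro h
    exact hi (congrArg Subtype.val h)
  have h2 : (zetaBasis p).coord i ∘ₗ lamAct p u (normY p u) = 0 := by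
    refine LinearMap.ext_on (span_zeta_pow p) ?_
    rintro _ ⟨n, rfl⟩
    change (zetaBasis p).repr (lamAct p u (normY p u) (zeta p ^ n)) i = 0
    rw [lamAct_normY p u hu]
    split_ifs
    · simpa using h1 (p - 1)
    · simpa using h1 (-1)
  exact LinearMap.congr_fun h2 z

/-- If `YA = A`, then the norm multiplies `A` by `p - 1` but has only its last row nonzero.
Conversely, the last column of `Y - 1` is zero because `y` fixes `1`. -/
lemma latticeRep_ly_sub_one_mul (A : Tri p) :
    latticeRep p u (ly p u - 1) * A = 0 ↔ ∀ i : Idx p, (i : ℕ) ≠ p - 1 → A.1 i = 0 := by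
  rw [map_sub, latticeRep_ly, map_one]
  constructor
  · intro h i hi
    rw [sub_mul, one_mul, sub_eq_zero] at h
    have h1 : ∀ k : ℕ, matY p u ^ k * A = A := by
      intro k
      induction k with
      | zero => rw [pow_zero, one_mul]
      | succ k ih => rw [pow_succ, mul_assoc, h, ih]
    have h2 : latticeRep p u (normY p u) * A = ((p - 1 : ℕ) : ℤ) • A := by
      rw [normY, map_sum, Finset.sum_mul]
      simp only [map_pow, latticeRep_ly, h1, Finset.sum_const, Finset.card_range]
      exact (natCast_zsmul _ _).symm
    funext j
    have h3 : ((latticeRep p u (normY p u)).1 * A.1) i j = ((p - 1 : ℕ) : ℤ) * A.1 i j :=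
      congrFun (congrFun (congrArg Subtype.val h2) i) j
    rw [Matrix.mul_apply, Finset.sum_eq_zero] at h3
    · have := one_le_pred p
      exact (mul_eq_zero.1 h3.symm).resolve_left (by omega)
    · intro k _
      rw [← toMatrix_lamAct, LinearMap.toMatrix_apply, repr_lamAct_normY p u hu _ i hi, zero_mul]
  · intro h
    apply Subtype.ext
    ext i j
    change (((matY p u).1 - 1) * A.1) i j = 0
    rw [Matrix.mul_apply]
    refine Finset.sum_eq_zero fun k _ => ?_
    by_cases hk : (k : ℕ) = p - 1
    · have : k = ⟨p - 1, last_mem_idx p⟩ := Subtype.ext hk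
      rw [this, Matrix.sub_apply, matY_apply_last, Matrix.one_apply, sub_self, zero_mul]
    · rw [h k hk]
      exact mul_zero _

end Tame

lemma latticeRep_lx_sub_one : latticeRep p u (lx p u - 1) = matX p - 1 := by
  rw [map_sub, latticeRep_lx, map_one]

lemma row_latticeRep_mem (a : Lam p u) (i : ↥((Finset.Icc 1 (p - 1)).erase 1)) :
    (latticeRep p u ((lx p u - 1) * a)).1 ⟨(i : ℕ) - 1, pred_mem_idx p i⟩ ∈ Row p i := by
  obtain ⟨b, hb⟩ := exists_lx_sub_one_mul p u a
  have h := vecMul_mem_row_succ p ((i : ℕ) - 1)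
    ((latticeRep p u b).1 ⟨(i : ℕ) - 1, pred_mem_idx p i⟩) (fun j hj => (latticeRep p u b).2 _ j hj)
  have hi := Finset.mem_Icc.1 (pred_mem_idx p i)
  rw [Nat.sub_add_cancel (by omega)] at h
  rw [hb, map_mul, latticeRep_lx_sub_one]
  exact h

/-- The map `Λ → R(1̂)` sending `a` to the rows `1, …, p - 2` of the matrix of `(x - 1)a`. -/
def toRowHat : Lam p u →ₗ[(Lam p u)ᵐᵒᵖ] RowHat p 1 where
  toFun a i := ⟨_, row_latticeRep_mem p u a i⟩
  map_add' a b := by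
    funext i
    apply Subtype.ext
    change (latticeRep p u ((lx p u - 1) * (a + b))).1 _ = _
    rw [mul_add, map_add]
    rfl
  map_smul' c a := by
    funext i
    apply Subtype.ext
    change (latticeRep p u ((lx p u - 1) * (a * c.unop))).1 _ = _
    rw [← mul_assoc, map_mul]
    rfl

lemma toRowHat_apply (a : Lam p u) (i : ↥((Finset.Icc 1 (p - 1)).erase 1)) :
    (toRowHat p u a i : Idx p → ℤ) =
      (latticeRep p u ((lx p u - 1) * a)).1 ⟨(i : ℕ) - 1, pred_mem_idx p i⟩ := rfl

/-- The map `Λ → [y - 1)` sending `a` to `(y - 1)(x - 1)a`. -/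
def toYIdeal : Lam p u →ₗ[(Lam p u)ᵐᵒᵖ] yIdeal p u where
  toFun a := ⟨(ly p u - 1) * ((lx p u - 1) * a), (mem_yIdeal p u _).2 ⟨_, rfl⟩⟩
  map_add' a b := by
    apply Subtype.ext
    change _ = (ly p u - 1) * ((lx p u - 1) * a) + (ly p u - 1) * ((lx p u - 1) * b)
    rw [← mul_add, ← mul_add]
  map_smul' c a := by
    apply Subtype.ext
    change (ly p u - 1) * ((lx p u - 1) * (a * c.unop)) =
      ((ly p u - 1) * ((lx p u - 1) * a)) * c.unop
    rw [mul_assoc, mul_assoc]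

variable (hu : orderOf u = p - 1)
include hu

lemma toRowHat_surjective : Function.Surjective (toRowHat p u) := by
  intro v
  have hp := (Fact.out : p.Prime).two_le
  have h1 : ∀ i : Idx p, ∃ w ∈ Row p i, ∀ h : (i : ℕ) + 1 ∈ (Finset.Icc 1 (p - 1)).erase 1,
      Matrix.vecMul w ((matX p).1 - 1) = v ⟨i + 1, h⟩ := by
    intro i
    by_cases h : (i : ℕ) + 1 ∈ (Finset.Icc 1 (p - 1)).erase 1
    · obtain ⟨w, hw, hwv⟩ := exists_vecMul_matX_sub_one p i i.2 _ (v ⟨i + 1, h⟩).2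
      exact ⟨w, hw, fun _ => hwv⟩
    -- This is the last row, `i = p - 1`, which `toRowHat` does not read; any value would do.
    · exact ⟨0, zero_mem _, fun h' => absurd h' h⟩
  choose w hw hwv using h1
  obtain ⟨b, hb⟩ := latticeRep_surjective p u hu ⟨Matrix.of w, fun i j h => hw i j h⟩
  -- The rows of `b` are prescribed before multiplication by `X - 1` on the right, while `toRowHat`
  -- multiplies by `x - 1` on the left.
  obtain ⟨a, ha⟩ := exists_mul_lx_sub_one p u b
  refine ⟨a, funext fun i => Subtype.ext ?_⟩
  have hi := Finset.mem_Icc.1 (pred_mem_idx p i)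
  have hi' : (i : ℕ) - 1 + 1 = i := by omega
  rw [toRowHat_apply, ← ha, map_mul, hb, latticeRep_lx_sub_one]
  have h2 := hwv ⟨(i : ℕ) - 1, pred_mem_idx p i⟩ (by rw [hi']; exact i.2)
  refine Eq.trans h2 ?_
  congr 2
  · simp only [hi']
  · simp only [hi']

/-- The element `(y - 1)(x - 1)a` already dies in `ℤ[C_{p-1}]`, so its vanishing can be tested in
`𝒯`. There `Y - 1` annihilates precisely the matrices supported in the last row. -/
lemma toRowHat_eq_zero_iff (a : Lam p u) : toRowHat p u a = 0 ↔ toYIdeal p u a = 0 := by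
  have h0 : toYIdeal p u a = 0 ↔
      latticeRep p u (ly p u - 1) * latticeRep p u ((lx p u - 1) * a) = 0 := by
    rw [← map_mul]
    constructor
    · intro h
      have h' : (ly p u - 1) * ((lx p u - 1) * a) = 0 := congrArg Subtype.val h
      rw [h', map_zero]
    · intro h
      refine Subtype.ext (eq_zero_of_latticeRep_eq_zero p u hu _ ?_ h)
      change toZC p u ((ly p u - 1) * ((lx p u - 1) * a)) = 0
      rw [map_mul, map_mul, map_sub _ (lx p u), toZC_lx, map_one, sub_self, zero_mul, mul_zero]
  rw [h0, latticeRep_ly_sub_one_mul p u hu]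
  constructor
  · intro h i hi
    have hi' := Finset.mem_Icc.1 i.2
    have h1 : (i : ℕ) + 1 ∈ (Finset.Icc 1 (p - 1)).erase 1 :=
      Finset.mem_erase.2 ⟨by omega, Finset.mem_Icc.2 (by omega)⟩
    exact congrArg Subtype.val (congrFun h ⟨i + 1, h1⟩)
  · intro h
    funext i
    apply Subtype.ext
    have h1 := Finset.mem_Icc.1 (Finset.mem_erase.1 i.2).2
    have h2 := (Finset.mem_erase.1 i.2).1
    exact h ⟨(i : ℕ) - 1, pred_mem_idx p i⟩ (show (i : ℕ) - 1 ≠ p - 1 by omega)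

/-- `toRowHat` and `toYIdeal` have the same kernel; the first is onto `R(1̂)`, and the second has
image `(y - 1)(x - 1)Λ`, the kernel of `yToAug`. -/
lemma exists_iota : ∃ ι : RowHat p 1 →ₗ[(Lam p u)ᵐᵒᵖ] yIdeal p u,
    Function.Injective ι ∧ Function.Exact ι (yToAug p u) := by
  have hs := toRowHat_surjective p u hu
  have hle : LinearMap.ker (toRowHat p u) ≤ LinearMap.ker (toYIdeal p u) :=
    fun a ha => (toRowHat_eq_zero_iff p u hu a).1 ha
  let ι : RowHat p 1 →ₗ[(Lam p u)ᵐᵒᵖ] yIdeal p u :=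
    (Submodule.liftQ (LinearMap.ker (toRowHat p u)) (toYIdeal p u) hle).comp
      ((toRowHat p u).quotKerEquivOfSurjective hs).symm.toLinearMap
  have hι : ∀ a, ι (toRowHat p u a) = toYIdeal p u a := by
    intro a
    have : ((toRowHat p u).quotKerEquivOfSurjective hs).symm (toRowHat p u a) =
        Submodule.Quotient.mk a := by
      rw [LinearEquiv.symm_apply_eq]
      rfl
    change Submodule.liftQ _ _ hle (((toRowHat p u).quotKerEquivOfSurjective hs).symm _) = _
    rw [this]
    rfl
  refine ⟨ι, (injective_iff_map_eq_zero _).2 fun v hv => ?_, fun a => ?_⟩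
  · obtain ⟨a, rfl⟩ := hs v
    rw [hι] at hv
    exact (toRowHat_eq_zero_iff p u hu a).2 hv
  · rw [yToAug_eq_zero_iff]
    constructor
    · rintro ⟨b, hb⟩
      exact ⟨toRowHat p u b, (hι b).trans (Subtype.ext hb.symm)⟩
    · rintro ⟨v, rfl⟩
      obtain ⟨b, rfl⟩ := hs v
      exact ⟨b, by rw [hι]; rfl⟩

end Iota

/-! ### Homomorphisms that factor through `R(1̂) → [y - 1)` -/

/-- Put `β(b) = s⁻¹ h(ι⁻¹(s b))`. Both inverses are unambiguous by injectivity, and `s * r = r' * s`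
yields linearity although `s` need not be central. It is used with `s = x - 1`. -/
lemma exists_extension {R M B W : Type*} [Ring R] [AddCommGroup M] [AddCommGroup B]
    [AddCommGroup W] [Module R M] [Module R B] [Module R W] (s : R)
    (hs : ∀ r : R, ∃ r', s * r = r' * s) (ι : M →ₗ[R] B) (hι : Function.Injective ι)
    (h : M →ₗ[R] W) (hB : ∀ b : B, ∃ v, ι v = s • b)
    (hW : Function.Injective fun w : W => s • w) (hh : ∀ v, ∃ w, h v = s • w) :
    ∃ β : B →ₗ[R] W, ∀ v, β (ι v) = h v := by
  choose j hj using hB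
  choose q hq using hh
  have huniq : ∀ b w v, ι v = s • b → h v = s • w → q (j b) = w := by
    intro b w v h1 h2
    have : j b = v := hι (by rw [hj, h1])
    apply hW
    change s • q (j b) = s • w
    rw [← hq, this, h2]
  refine ⟨{ toFun := fun b => q (j b), map_add' := fun a b => ?_, map_smul' := fun r b => ?_ },
    fun v => ?_⟩
  · apply huniq _ _ (j a + j b)
    · rw [map_add, hj, hj, smul_add]
    · rw [map_add, hq, hq, smul_add]
  · obtain ⟨r', hr⟩ := hs r
    apply huniq _ _ (r' • j b)
    · rw [map_smul, hj, ← mul_smul, ← mul_smul, hr]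
    · rw [map_smul, hq, ← mul_smul, RingHom.id_apply, ← mul_smul, hr]
  · apply huniq _ _ (s • v)
    · rw [map_smul]
    · rw [map_smul]

section Factor

variable (p : ℕ) [Fact p.Prime] (u : (ZMod p)ˣ)

/-- The element `x - 1`, acting on right modules. -/
def sx : (Lam p u)ᵐᵒᵖ := MulOpposite.op (lx p u - 1)

lemma sx_smul_row (k : ℕ) (w : Row p k) :
    ((sx p u • w : Row p k) : Idx p → ℤ) = Matrix.vecMul (w : Idx p → ℤ) ((matX p).1 - 1) := by
  rw [row_smul_def, sx, MulOpposite.unop_op, latticeRep_lx_sub_one]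
  rfl

lemma exists_sx_mul (r : (Lam p u)ᵐᵒᵖ) : ∃ r', sx p u * r = r' * sx p u := by
  obtain ⟨b, hb⟩ := exists_mul_lx_sub_one p u r.unop
  exact ⟨MulOpposite.op b, MulOpposite.unop_injective hb⟩

lemma exists_eq_sx_smul_iff (k : ℕ) (hk : k ∈ Finset.Icc 1 (p - 1)) (v : Row p k) :
    (∃ w, v = sx p u • w) ↔ (p : ℤ) ∣ (v : Idx p → ℤ) ⟨k, hk⟩ := by
  constructor
  · rintro ⟨w, rfl⟩
    rw [sx_smul_row]
    exact vecMul_mem_row_succ p k w w.2 _ (Nat.lt_succ_self k)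
  · intro h
    obtain ⟨w, hw, hwv⟩ := exists_vecMul_matX_sub_one p k hk v (by
      intro j hj
      rcases Nat.lt_or_ge j k with h' | h'
      · exact v.2 j h'
      · have : j = ⟨k, hk⟩ := Subtype.ext (show (j : ℕ) = k by omega)
        rwa [this])
    exact ⟨⟨w, hw⟩, Subtype.ext (by rw [sx_smul_row, hwv])⟩

variable (ι : RowHat p 1 →ₗ[(Lam p u)ᵐᵒᵖ] yIdeal p u) (hex : Function.Exact ι (yToAug p u))
include hex

lemma exists_iota_eq_sx_smul (b : yIdeal p u) : ∃ v, ι v = sx p u • b := by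
  refine (hex _).1 (Subtype.ext ?_)
  change toZC p u ((b : Lam p u) * (lx p u - 1)) = 0
  rw [map_mul, map_sub, toZC_lx, map_one, sub_self, mul_zero]

/-- The kernel `(y - 1)(x - 1)Λ` equals `(y - 1)Λ(x - 1)`. With `exists_iota_eq_sx_smul`, the image
of `ι` is exactly `[y - 1)(x - 1)`. -/
lemma exists_sx_smul_eq_iota (v : RowHat p 1) : ∃ b, ι v = sx p u • b := by
  obtain ⟨b, hb⟩ := (yToAug_eq_zero_iff p u _).1 ((hex (ι v)).2 ⟨v, rfl⟩)
  obtain ⟨c, hc⟩ := exists_lx_sub_one_mul p u b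
  refine ⟨⟨(ly p u - 1) * c, (mem_yIdeal p u _).2 ⟨c, rfl⟩⟩, Subtype.ext ?_⟩
  rw [hb, hc, ← mul_assoc]
  rfl

/-- A homomorphism `R(1̂) → R(k)` factors through `ι` if and only if its image lies in
`R(k)(x - 1)`. -/
lemma exists_comp_iota_iff (hι : Function.Injective ι) (k : ℕ) (hk : k ∈ Finset.Icc 1 (p - 1))
    (h : RowHat p 1 →ₗ[(Lam p u)ᵐᵒᵖ] Row p k) :
    (∃ β : yIdeal p u →ₗ[(Lam p u)ᵐᵒᵖ] Row p k, ∀ v, β (ι v) = h v) ↔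
      ∀ v, (p : ℤ) ∣ (h v : Idx p → ℤ) ⟨k, hk⟩ := by
  constructor
  · rintro ⟨β, hβ⟩ v
    obtain ⟨b, hb⟩ := exists_sx_smul_eq_iota p u ι hex v
    exact (exists_eq_sx_smul_iff p u k hk _).1 ⟨β b, by rw [← hβ, hb, map_smul]⟩
  · intro hh
    refine exists_extension (sx p u) (exists_sx_mul p u) ι hι h
      (exists_iota_eq_sx_smul p u ι hex) ?_
      fun v => (exists_eq_sx_smul_iff p u k hk _).2 (hh v)
    intro v w hvw
    apply Subtype.ext
    apply vecMul_matX_sub_one_injective p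
    change Matrix.vecMul _ _ = Matrix.vecMul _ _
    rw [← sx_smul_row p u, ← sx_smul_row p u]
    exact congrArg Subtype.val hvw

end Factor

/-! ### Homomorphisms between the rows -/

section Hom

variable (p : ℕ) [Fact p.Prime] (u : (ZMod p)ˣ)

/-- The standard generator of `R(j)`. -/
def rowGen (j : ℕ) (hj : j ∈ Finset.Icc 1 (p - 1)) : Row p j :=
  ⟨Pi.single ⟨j, hj⟩ 1, fun i hi => by
    rw [Pi.single_eq_of_ne]
    · exact dvd_zero _
    · rintro rfl
      exact lt_irrefl _ hi⟩

variable (hu : orderOf u = p - 1)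
include hu

/-- The matrix with `v` in row `j` and zeros elsewhere lies in `𝒯`, so it comes from some `a` in
`Λ`. This `a` sends every row vector `w` to `w_j • v`; apply it to the generator and to its image
under `f`. -/
lemma row_hom_apply (j k : ℕ) (hj : j ∈ Finset.Icc 1 (p - 1))
    (f : Row p j →ₗ[(Lam p u)ᵐᵒᵖ] Row p k) (v : Row p j) :
    (f v : Idx p → ℤ) =
      (f (rowGen p j hj) : Idx p → ℤ) ⟨j, hj⟩ • (v : Idx p → ℤ) := by
  have hA : Matrix.updateRow 0 ⟨j, hj⟩ (v : Idx p → ℤ) ∈ Tri p := by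
    intro i l h
    by_cases hi : i = ⟨j, hj⟩
    · subst hi
      rw [Matrix.updateRow_self]
      exact v.2 l h
    · rw [Matrix.updateRow_ne hi]
      exact dvd_zero _
  obtain ⟨a, ha⟩ := latticeRep_surjective p u hu ⟨_, hA⟩
  have key : ∀ w : Idx p → ℤ, Matrix.vecMul w (latticeRep p u a).1 =
      w ⟨j, hj⟩ • (v : Idx p → ℤ) := by
    intro w
    rw [ha]
    funext l
    change ∑ i, w i * Matrix.updateRow 0 ⟨j, hj⟩ (v : Idx p → ℤ) i l = _
    rw [Finset.sum_eq_single ⟨j, hj⟩]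
    · rw [Matrix.updateRow_self]
      rfl
    · intro i _ hi
      rw [Matrix.updateRow_ne hi]
      exact mul_zero _
    · simp
  have hv : v = MulOpposite.op a • rowGen p j hj := by
    apply Subtype.ext
    rw [row_smul_def, MulOpposite.unop_op, key]
    simp [rowGen]
  conv_lhs => rw [hv, map_smul, row_smul_def, MulOpposite.unop_op, key]

/-- The image of a homomorphism `R(1̂) → R(k)` lies in `R(k)(x - 1)` if and only if the scalar by
which it acts on the summand `R(k)` is divisible by `p`. -/
lemma forall_dvd_iff (k : ℕ) (hk : k ∈ (Finset.Icc 1 (p - 1)).erase 1)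
    (h : RowHat p 1 →ₗ[(Lam p u)ᵐᵒᵖ] Row p k) :
    (∀ v, (p : ℤ) ∣ (h v : Idx p → ℤ) ⟨k, Finset.mem_of_mem_erase hk⟩) ↔
      (p : ℤ) ∣ (h (Pi.single ⟨k, hk⟩ (rowGen p k (Finset.mem_of_mem_erase hk))) : Idx p → ℤ)
        ⟨k, Finset.mem_of_mem_erase hk⟩ := by
  refine ⟨fun H => H _, fun H v => ?_⟩
  rw [← Finset.univ_sum_single v, map_sum, AddSubgroup.val_finsetSum, Finset.sum_apply]
  refine Finset.dvd_sum fun i _ => ?_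
  have hi := Finset.mem_of_mem_erase i.2
  have h1 := row_hom_apply p u hu i k hi
    (h ∘ₗ LinearMap.single (Lam p u)ᵐᵒᵖ (fun i : ↥((Finset.Icc 1 (p - 1)).erase 1) => Row p i) i)
    (v i)
  simp only [LinearMap.comp_apply, LinearMap.single_apply] at h1
  rw [h1, Pi.smul_apply, smul_eq_mul]
  -- For `i < k` the scalar itself is divisible by `p`, being an entry left of position `k` of a
  -- vector in `R(k)`. For `i > k` the `k`-th entry of a vector in `R(i)` is divisible by `p`.
  rcases lt_trichotomy (i : ℕ) k with h2 | h2 | h2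
  · exact ((h (Pi.single i (rowGen p i hi))).2 ⟨i, hi⟩ h2).mul_right _
  · have : i = ⟨k, hk⟩ := Subtype.ext h2
    subst this
    exact H.mul_right _
  · exact ((v i).2 ⟨k, _⟩ h2).mul_left _

end Hom

/-! ### Vanishing of `Ext¹([y - 1), R(2) ⊕ R(1̂))` -/

section Vanishing

open Abelian in
lemma extClass_comp_mk₀_eq_zero_iff {𝒜 : Type*} [Category 𝒜] [Abelian 𝒜] [HasExt 𝒜]
    {S : ShortComplex 𝒜} (hS : S.ShortExact) {Y : 𝒜} (φ : S.X₁ ⟶ Y) :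
    hS.extClass.comp (Ext.mk₀ φ) (add_zero 1) = 0 ↔ ∃ β : S.X₂ ⟶ Y, S.f ≫ β = φ := by
  constructor
  · intro h
    obtain ⟨x₂, hx₂⟩ := Ext.contravariant_sequence_exact₁ hS _ _ (add_zero 1) h
    obtain ⟨β, rfl⟩ := (Ext.mk₀_bijective _ _).2 x₂
    rw [Ext.mk₀_comp_mk₀] at hx₂
    exact ⟨β, (Ext.mk₀_bijective _ _).1 hx₂⟩
  · rintro ⟨β, rfl⟩
    rw [← Ext.mk₀_comp_mk₀]
    exact hS.extClass_comp_assoc _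

open Abelian in
lemma exists_extClass_comp_mk₀_eq {𝒜 : Type*} [Category 𝒜] [Abelian 𝒜] [HasExt 𝒜]
    {S : ShortComplex 𝒜} (hS : S.ShortExact) {Y : 𝒜} (ξ : Ext S.X₃ Y 1)
    (hξ : (Ext.mk₀ S.g).comp ξ (zero_add 1) = 0) :
    ∃ φ : S.X₁ ⟶ Y, hS.extClass.comp (Ext.mk₀ φ) (add_zero 1) = ξ := by
  obtain ⟨x₁, rfl⟩ := Ext.contravariant_sequence_exact₃ hS _ ξ hξ (add_zero 1)
  obtain ⟨φ, rfl⟩ := (Ext.mk₀_bijective _ _).2 x₁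
  exact ⟨φ, rfl⟩

open Abelian in
lemma comp_mk₀_sub {𝒜 : Type*} [Category 𝒜] [Abelian 𝒜] [HasExt 𝒜] {X Y Z : 𝒜} (ξ : Ext X Y 1)
    (φ ψ : Y ⟶ Z) : ξ.comp (Ext.mk₀ (φ - ψ)) (add_zero 1) =
      ξ.comp (Ext.mk₀ φ) (add_zero 1) - ξ.comp (Ext.mk₀ ψ) (add_zero 1) := by
  rw [sub_eq_add_neg, Ext.mk₀_add, Ext.mk₀_neg, Ext.comp_add, Ext.comp_neg, ← sub_eq_add_neg]

open Abelian in
-- The map onto `I(C_{p-1})` factors through `[y - 1)`, so nothing about `Ext¹` out of the summand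
-- `R(2)` is needed.
lemma comp_eq_zero_of_factor {𝒜 : Type*} [Category 𝒜] [Abelian 𝒜] [HasExt 𝒜] {X Y Z W : 𝒜}
    (f : X ⟶ Y) (g : Y ⟶ Z) (ξ : Ext Z W 1) (h : ∀ x : Ext Y W 1, x = 0) :
    (Ext.mk₀ (f ≫ g)).comp ξ (zero_add 1) = 0 := by
  rw [← Ext.mk₀_comp_mk₀_assoc, h ((Ext.mk₀ g).comp ξ (zero_add 1)), Ext.comp_zero]

lemma component_zsmul (p : ℕ) (n : ℤ) (v : RSum p) (i : Idx p) :
    component p (n • v) i = n • component p v i := by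
  unfold component
  split_ifs <;> rfl

variable (p : ℕ) [Fact p.Prime] (u : (ZMod p)ˣ)

lemma rSum_eq_zero_of_zsmul (n : ℤ) (hn : n ≠ 0) (v : RSum p) (h : n • v = 0) : v = 0 := by
  have h0 : ∀ i, component p (0 : RSum p) i = 0 := by
    intro i
    unfold component
    split_ifs <;> rfl
  refine component_ext p (one_le_pred p) fun i => ?_
  have h1 := component_zsmul p n v i
  rw [h, h0] at h1
  rw [h0]
  exact (smul_eq_zero.1 h1.symm).resolve_left hn

lemma sum_lx_smul (v : RSum p) :
    MulOpposite.op (∑ i ∈ Finset.range p, lx p u ^ i) • v = 0 := by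
  refine component_ext p (one_le_pred p) fun i => ?_
  rw [component_smul, MulOpposite.unop_op, latticeRep_sum_lx]
  change Matrix.vecMul _ (0 : Matrix (Idx p) (Idx p) ℤ) = _
  rw [Matrix.vecMul_zero]
  unfold component
  split_ifs <;> rfl

lemma lx_mul_ly_pow (k : ℕ) :
    lx p u * ly p u ^ k = ly p u ^ k * lx p u ^ (((u⁻¹ ^ k : (ZMod p)ˣ)) : ZMod p).val := by
  rw [lx, ly, ← map_pow, ← map_pow, ← map_mul, ← map_mul, gx_mul_gy_pow, inv_pow]

/-- Moving `y ^ k` past `x` turns `v x y ^ k` into `v x ^ (u ^ (-k))`, since `v` is fixed by `y`.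
Summed over `k` this is `v` times all nontrivial powers of `x`, that is `-v`. -/
lemma normY_smul_lx_smul (hu : orderOf u = p - 1) (v : RSum p)
    (hv : MulOpposite.op (ly p u) • v = v) :
    MulOpposite.op (normY p u) • MulOpposite.op (lx p u) • v = -v := by
  have hy : ∀ k : ℕ, MulOpposite.op (ly p u ^ k) • v = v := by
    intro k
    induction k with
    | zero => rw [pow_zero, MulOpposite.op_one, one_smul]
    | succ k ih => rw [pow_succ, MulOpposite.op_mul, mul_smul, ih, hv]
  have h1 : ∑ a ∈ Finset.univ.erase 0, MulOpposite.op (lx p u ^ (a : ZMod p).val) • v = -v := by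
    have h2 := Finset.add_sum_erase Finset.univ
      (fun a : ZMod p => MulOpposite.op (lx p u ^ a.val) • v) (Finset.mem_univ 0)
    have h3 : ∑ a : ZMod p, MulOpposite.op (lx p u ^ a.val) • v = 0 := by
      rw [← sum_lx_smul p u v, Finset.op_sum, Finset.sum_smul]
      refine (Finset.sum_bij' (fun i _ => (i : ZMod p)) (fun a _ => a.val) ?_ ?_ ?_ ?_ ?_ :
        ∑ i ∈ Finset.range p, MulOpposite.op (lx p u ^ i) • v = _).symm
      · intro i _
        exact Finset.mem_univ _
      · intro a _
        exact Finset.mem_range.2 a.val_lt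
      · intro i hi
        exact ZMod.val_cast_of_lt (Finset.mem_range.1 hi)
      · intro a _
        exact ZMod.natCast_zmod_val a
      · intro i hi
        rw [ZMod.val_cast_of_lt (Finset.mem_range.1 hi)]
    rw [h3, ZMod.val_zero, pow_zero, MulOpposite.op_one, one_smul] at h2
    exact (neg_eq_of_add_eq_zero_right h2).symm
  rw [← mul_smul, ← MulOpposite.op_mul, normY, Finset.mul_sum, Finset.op_sum, Finset.sum_smul,
    ← h1, ← sum_mul_pow p u⁻¹ (by rw [orderOf_inv, hu])
      (fun a => MulOpposite.op (lx p u ^ (a : ZMod p).val) • v) 1 one_ne_zero]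
  refine Finset.sum_congr rfl fun k _ => ?_
  rw [lx_mul_ly_pow, MulOpposite.op_mul, mul_smul, hy, one_mul]

/-- The generator `y - 1` of `[y - 1)`. -/
def yGen : yIdeal p u := ⟨ly p u - 1, Submodule.subset_span rfl⟩

/-- The presentation `Λ → [y - 1)`, `1 ↦ y - 1`. -/
def yPres : (Lam p u)ᵐᵒᵖ →ₗ[(Lam p u)ᵐᵒᵖ] yIdeal p u :=
  LinearMap.toSpanSingleton (Lam p u)ᵐᵒᵖ (yIdeal p u) (yGen p u)

lemma mem_ker_yPres (r : (Lam p u)ᵐᵒᵖ) :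
    r ∈ LinearMap.ker (yPres p u) ↔ (ly p u - 1) * r.unop = 0 :=
  Subtype.ext_iff

lemma yPres_surjective : Function.Surjective (yPres p u) := by
  intro a
  obtain ⟨b, hb⟩ := (mem_yIdeal p u a).1 a.2
  exact ⟨MulOpposite.op b, Subtype.ext hb⟩

/-- Every homomorphism from the annihilator of `y - 1` extends to `Λ`. Its value at the norm element
is fixed by `y`, hence is the norm of an explicit `s` by `normY_smul_lx_smul`. That value determines
`f`, because `p - 1` times any annihilator element is a multiple of the norm and the target is
torsion-free. -/
lemma exists_smul_of_ker_yPres (hu : orderOf u = p - 1)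
    (f : LinearMap.ker (yPres p u) →ₗ[(Lam p u)ᵐᵒᵖ] RSum p) :
    ∃ s : RSum p, ∀ r : LinearMap.ker (yPres p u), f r = (r : (Lam p u)ᵐᵒᵖ) • s := by
  let e : LinearMap.ker (yPres p u) :=
    ⟨MulOpposite.op (normY p u), (mem_ker_yPres p u _).2 (ly_sub_one_mul_normY p u)⟩
  have he : MulOpposite.op (ly p u) • f e = f e := by
    rw [← map_smul]
    congr 1
    apply Subtype.ext
    apply MulOpposite.unop_injective
    change normY p u * ly p u = normY p u
    have := normY_mul_ly_sub_one p u
    rwa [mul_sub, mul_one, sub_eq_zero] at this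
  have hs : MulOpposite.op (normY p u) • (-(MulOpposite.op (lx p u) • f e)) = f e := by
    rw [smul_neg, normY_smul_lx_smul p u hu _ he, neg_neg]
  refine ⟨-(MulOpposite.op (lx p u) • f e), fun r => ?_⟩
  have hr := (mem_ker_yPres p u r).1 r.2
  have h1 : r.1 * MulOpposite.op (normY p u) = ((p - 1 : ℕ) : ℤ) • r.1 := by
    apply MulOpposite.unop_injective
    change normY p u * r.1.unop = ((p - 1 : ℕ) : ℤ) • r.1.unop
    have h2 : ∀ k : ℕ, ly p u ^ k * r.1.unop = r.1.unop := by
      intro k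
      induction k with
      | zero => rw [pow_zero, one_mul]
      | succ k ih =>
        rw [sub_mul, one_mul, sub_eq_zero] at hr
        rw [pow_succ, mul_assoc, hr, ih]
    rw [normY, Finset.sum_mul]
    simp only [h2, Finset.sum_const, Finset.card_range, natCast_zsmul]
  have h3 : ((p - 1 : ℕ) : ℤ) • (f r - r.1 • (-(MulOpposite.op (lx p u) • f e))) = 0 := by
    rw [smul_sub, ← smul_assoc, ← h1, mul_smul, hs, ← map_smul f, ← map_zsmul f, ← map_sub f]
    have : ((p - 1 : ℕ) : ℤ) • r - r.1 • e = 0 := by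
      apply Subtype.ext
      change ((p - 1 : ℕ) : ℤ) • r.1 - r.1 * MulOpposite.op (normY p u) = 0
      rw [h1, sub_self]
    rw [this, map_zero]
  have := one_le_pred p
  exact sub_eq_zero.1 (rSum_eq_zero_of_zsmul p _ (by omega) _ h3)

/-- The short complex `ker → Λ → [y - 1)`. -/
def yComplex : ShortComplex (ModuleCat.{0} (Lam p u)ᵐᵒᵖ) :=
  ShortComplex.mk
    (X₁ := ModuleCat.of (Lam p u)ᵐᵒᵖ (LinearMap.ker (yPres p u)))
    (X₂ := ModuleCat.of (Lam p u)ᵐᵒᵖ (Lam p u)ᵐᵒᵖ)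
    (X₃ := ModuleCat.of (Lam p u)ᵐᵒᵖ (yIdeal p u))
    (ModuleCat.ofHom (LinearMap.ker (yPres p u)).subtype)
    (ModuleCat.ofHom (yPres p u))
    (by
      refine ModuleCat.hom_ext (LinearMap.ext fun v => ?_)
      exact v.2)

lemma yComplex_shortExact : (yComplex p u).ShortExact := by
  refine ModuleCat.shortComplex_shortExact (yComplex p u) ?_ ?_ ?_
  · intro r
    constructor
    · intro h
      exact ⟨⟨r, h⟩, rfl⟩
    · rintro ⟨r, rfl⟩
      exact r.2
  · exact Subtype.val_injective
  · exact yPres_surjective p u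

/-- `Λ` is projective, so a class comes from a homomorphism on the kernel of `Λ → [y - 1)`, and each
of these extends to `Λ`. -/
lemma ext_yIdeal_eq_zero (hu : orderOf u = p - 1)
    (x : Abelian.Ext.{0} (ModuleCat.of (Lam p u)ᵐᵒᵖ (yIdeal p u))
      (ModuleCat.of (Lam p u)ᵐᵒᵖ (RSum p)) 1) : x = 0 := by
  have hproj : Projective (yComplex p u).X₂ :=
    (IsProjective.iff_projective (Lam p u)ᵐᵒᵖ).1 inferInstance
  obtain ⟨f, rfl⟩ := exists_extClass_comp_mk₀_eq (yComplex_shortExact p u) x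
    (Abelian.Ext.eq_zero_of_projective _)
  obtain ⟨s, hs⟩ := exists_smul_of_ker_yPres p u hu f.hom
  refine (extClass_comp_mk₀_eq_zero_iff (yComplex_shortExact p u) f).2
    ⟨ModuleCat.ofHom (LinearMap.toSpanSingleton (Lam p u)ᵐᵒᵖ (RSum p) s),
      ModuleCat.hom_ext (LinearMap.ext fun r => (hs r).symm)⟩

end Vanishing

/-! ### Push-outs of the standard extension -/

section PushOut

variable (p : ℕ) [Fact p.Prime] (u : (ZMod p)ˣ)
  (ι : RowHat p 1 →ₗ[(Lam p u)ᵐᵒᵖ] yIdeal p u) (hι : Function.Injective ι)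
  (hex : Function.Exact ι (yToAug p u))

lemma pushExt_sub (φ ψ : RSum p →ₗ[(Lam p u)ᵐᵒᵖ] RSum p) :
    pushExt p u ι hι hex (φ - ψ) = pushExt p u ι hι hex φ - pushExt p u ι hι hex ψ := by
  exact comp_mk₀_sub _ (ModuleCat.ofHom φ) (ModuleCat.ofHom ψ)

lemma pushExt_eq_zero_iff (φ : RSum p →ₗ[(Lam p u)ᵐᵒᵖ] RSum p) :
    pushExt p u ι hι hex φ = 0 ↔
      ∃ β : (Row p 2 × yIdeal p u) →ₗ[(Lam p u)ᵐᵒᵖ] RSum p,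
        ∀ v, β (v.1, ι v.2) = φ v := by
  refine (extClass_comp_mk₀_eq_zero_iff (stdComplex_shortExact p u ι hι hex)
    (ModuleCat.ofHom φ)).trans ⟨?_, ?_⟩
  · rintro ⟨β, hβ⟩
    exact ⟨β.hom, fun v => LinearMap.congr_fun (congrArg ModuleCat.Hom.hom hβ) v⟩
  · rintro ⟨β, hβ⟩
    exact ⟨ModuleCat.ofHom β, ModuleCat.hom_ext (LinearMap.ext hβ)⟩

lemma exists_eq_pushExt (hu : orderOf u = p - 1) (ξ : ExtOne p u) :
    ∃ φ, ξ = pushExt p u ι hι hex φ := by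
  obtain ⟨φ, hφ⟩ := exists_extClass_comp_mk₀_eq (stdComplex_shortExact p u ι hι hex) ξ
    (comp_eq_zero_of_factor
      (ModuleCat.ofHom (LinearMap.snd (Lam p u)ᵐᵒᵖ (Row p 2) (yIdeal p u)))
      (ModuleCat.ofHom (yToAug p u)) ξ (ext_yIdeal_eq_zero p u hu))
  exact ⟨φ.hom, hφ.symm⟩

/-- The `i`-th projection of `R(2) ⊕ R(2) ⊕ R(3) ⊕ ⋯ ⊕ R(p - 1)`. -/
def componentLin (i : Idx p) : RSum p →ₗ[(Lam p u)ᵐᵒᵖ] Row p (rowOf p i) where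
  toFun v := ⟨component p v i, component_mem p v i⟩
  map_add' v w := Subtype.ext (component_add p v w i)
  map_smul' a v := Subtype.ext (component_smul p u a v i)

/-- The homomorphism into `R(2) ⊕ R(2) ⊕ R(3) ⊕ ⋯ ⊕ R(p - 1)` with given components. -/
def linOfComponents {M : Type*} [AddCommGroup M] [Module (Lam p u)ᵐᵒᵖ M]
    (f : (i : Idx p) → M →ₗ[(Lam p u)ᵐᵒᵖ] Row p (rowOf p i)) :
    M →ₗ[(Lam p u)ᵐᵒᵖ] RSum p where
  toFun a := ofComponents p (one_le_pred p) (fun i => f i a) fun i => (f i a).2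
  map_add' a b := by
    refine component_ext p (one_le_pred p) fun i => ?_
    rw [component_add, component_ofComponents, component_ofComponents, component_ofComponents,
      map_add]
    rfl
  map_smul' c a := by
    refine component_ext p (one_le_pred p) fun i => ?_
    rw [RingHom.id_apply, component_smul, component_ofComponents, component_ofComponents, map_smul,
      row_smul_def]

lemma componentLin_linOfComponents {M : Type*} [AddCommGroup M] [Module (Lam p u)ᵐᵒᵖ M]
    (f : (i : Idx p) → M →ₗ[(Lam p u)ᵐᵒᵖ] Row p (rowOf p i)) (a : M) (i : Idx p) :
    componentLin p u i (linOfComponents p u f a) = f i a :=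
  Subtype.ext (component_ofComponents p (one_le_pred p) (fun i => (f i a : Idx p → ℤ))
    (fun i => (f i a).2) i)

/-- On the first `R(2)` the map `id ⊕ ι` is the identity, so only the restriction of `φ` to `R(1̂)`
matters, one target component at a time. -/
lemma exists_factor_iff (φ : RSum p →ₗ[(Lam p u)ᵐᵒᵖ] RSum p) :
    (∃ β : (Row p 2 × yIdeal p u) →ₗ[(Lam p u)ᵐᵒᵖ] RSum p, ∀ v, β (v.1, ι v.2) = φ v) ↔
      ∀ i, ∃ β : yIdeal p u →ₗ[(Lam p u)ᵐᵒᵖ] Row p (rowOf p i),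
        ∀ v, β (ι v) = componentLin p u i (φ (0, v)) := by
  constructor
  · rintro ⟨β, hβ⟩ i
    refine ⟨componentLin p u i ∘ₗ β ∘ₗ LinearMap.inr _ _ _, fun v => ?_⟩
    rw [← hβ]
    rfl
  · intro h
    choose β hβ using h
    refine ⟨(φ ∘ₗ LinearMap.inl _ _ _).coprod (linOfComponents p u β), fun v => ?_⟩
    have h1 : linOfComponents p u β (ι v.2) = φ (0, v.2) := by
      refine component_ext p (one_le_pred p) fun i => ?_
      have h2 := componentLin_linOfComponents p u β (ι v.2) i
      rw [hβ] at h2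
      exact congrArg Subtype.val h2
    rw [LinearMap.coprod_apply, h1, LinearMap.comp_apply, LinearMap.inl_apply, ← map_add,
      Prod.mk_add_mk, add_zero, zero_add]

end PushOut

/-! ### Residues modulo `p` that classify push-outs, and their sparse representatives -/

section Main

variable (p : ℕ) [Fact p.Prime] (hp : p ≠ 2) (u : (ZMod p)ˣ)
include hp

lemma rowOf_mem (i : Idx p) : rowOf p i ∈ (Finset.Icc 1 (p - 1)).erase 1 := by
  have hi := Finset.mem_Icc.1 i.2
  have := (Fact.out : p.Prime).two_le
  rw [Finset.mem_erase, Finset.mem_Icc]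
  unfold rowOf
  split_ifs <;> omega

/-- The index `rowOf i`. -/
def rowIdx (i : Idx p) : Idx p := ⟨rowOf p i, Finset.mem_of_mem_erase (rowOf_mem p hp i)⟩

/-- The standard generator of the summand `R(rowOf i)` of `R(1̂)`. -/
def hatGen (i : Idx p) : RSum p :=
  (0, Pi.single ⟨rowOf p i, rowOf_mem p hp i⟩
    (rowGen p (rowOf p i) (Finset.mem_of_mem_erase (rowOf_mem p hp i))))

lemma component_hatGen (i j : Idx p) :
    component p (hatGen p hp i) j (rowIdx p hp i) = if j = rowIdx p hp i then 1 else 0 := by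
  have h2 := Finset.mem_erase.1 (rowOf_mem p hp i)
  unfold component
  split_ifs with h h' h'
  · exact absurd (congrArg Subtype.val h') (by rw [h]; exact h2.1.symm)
  · rfl
  · subst h'
    change ((Pi.single (M := fun i : ↥((Finset.Icc 1 (p - 1)).erase 1) => Row p i) ⟨rowOf p i, _⟩
      (rowGen p (rowOf p i) _) ⟨rowOf p i, _⟩ : Row p (rowOf p i)) : Idx p → ℤ) _ = 1
    rw [Pi.single_eq_same]
    exact Pi.single_eq_same _ _
  · change ((Pi.single (M := fun i : ↥((Finset.Icc 1 (p - 1)).erase 1) => Row p i) ⟨rowOf p i, _⟩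
      (rowGen p (rowOf p i) _) ⟨j, _⟩ : Row p j) : Idx p → ℤ) _ = 0
    rw [Pi.single_eq_of_ne]
    · rfl
    · intro h3
      have h4 : (j : ℕ) = rowOf p i := congrArg Subtype.val h3
      exact h' (Subtype.ext h4)

/-- The scalar by which the `i`-th component of `φ` acts on the summand `R(rowOf i)` of `R(1̂)`. -/
def diagScalar (φ : RSum p →ₗ[(Lam p u)ᵐᵒᵖ] RSum p) (i : Idx p) : ℤ :=
  component p (φ (hatGen p hp i)) i (rowIdx p hp i)

lemma diagScalar_sub (φ ψ : RSum p →ₗ[(Lam p u)ᵐᵒᵖ] RSum p) (i : Idx p) :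
    diagScalar p hp u (φ - ψ) i = diagScalar p hp u φ i - diagScalar p hp u ψ i := by
  unfold diagScalar
  rw [LinearMap.sub_apply]
  exact congrFun (congrArg Subtype.val (map_sub (componentLin p u i) _ _)) _

lemma diagScalar_endOfMatrix (A : Matrix (Idx p) (Idx p) ℤ) (hA : IsEndMatrix p A) (i : Idx p) :
    diagScalar p hp u (endOfMatrix p u A hA) i = A i (rowIdx p hp i) := by
  unfold diagScalar
  change component p (ofComponents p _ _ _) i _ = _
  rw [component_ofComponents, Finset.sum_apply]
  simp only [Pi.smul_apply, component_hatGen, smul_eq_mul, mul_ite, mul_one, mul_zero,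
    Finset.sum_ite_eq', Finset.mem_univ, if_true]

lemma pushExt_eq_zero_iff_dvd (hu : orderOf u = p - 1)
    (ι : RowHat p 1 →ₗ[(Lam p u)ᵐᵒᵖ] yIdeal p u) (hι : Function.Injective ι)
    (hex : Function.Exact ι (yToAug p u)) (φ : RSum p →ₗ[(Lam p u)ᵐᵒᵖ] RSum p) :
    pushExt p u ι hι hex φ = 0 ↔ ∀ i, (p : ℤ) ∣ diagScalar p hp u φ i := by
  rw [pushExt_eq_zero_iff, exists_factor_iff p u ι]
  refine forall_congr' fun i => ?_
  let h : RowHat p 1 →ₗ[(Lam p u)ᵐᵒᵖ] Row p (rowOf p i) :=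
    componentLin p u i ∘ₗ φ ∘ₗ LinearMap.inr _ _ _
  have hk := rowOf_mem p hp i
  exact (exists_comp_iota_iff p u ι hex hι _ (Finset.mem_of_mem_erase hk) h).trans
    (forall_dvd_iff p u hu _ hk h)

/-- The only entry of row `i` that may be nonzero is the one read by `diagScalar`; hence residues
determine sparse matrices. -/
lemma IsSparse.apply_eq_zero {A : Matrix (Idx p) (Idx p) ℤ} (hA : IsSparse p A) (i j : Idx p)
    (hij : j ≠ rowIdx p hp i) : A i j = 0 := by
  have hi := Finset.mem_Icc.1 i.2
  apply hA.eq_zero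
  · rintro ⟨h1, h2⟩
    apply hij
    apply Subtype.ext
    change (j : ℕ) = rowOf p i
    rw [rowOf, if_pos h1, h2]
  · rintro ⟨rfl, h2⟩
    apply hij
    apply Subtype.ext
    change (i : ℕ) = rowOf p i
    rw [rowOf, if_neg (by omega)]

/-- The sparse matrix with prescribed nonzero entries modulo `p`. -/
def sparseMatrix (d : Idx p → ℤ) : Matrix (Idx p) (Idx p) ℤ :=
  Matrix.of fun i j => if j = rowIdx p hp i then d i % p else 0

lemma isSparse_sparseMatrix (d : Idx p → ℤ) : IsSparse p (sparseMatrix p hp d) := by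
  have hpos : (0 : ℤ) < p := by exact_mod_cast (Fact.out : p.Prime).pos
  refine ⟨fun i j => ?_, fun i j => ?_, fun i j h1 h2 => ?_⟩ <;>
    simp only [sparseMatrix, Matrix.of_apply]
  · split_ifs
    · exact Int.emod_nonneg _ hpos.ne'
    · rfl
  · split_ifs
    · have := Int.emod_lt_of_pos (d i) hpos
      omega
    · omega
  · rw [if_neg]
    intro h
    have hi := Finset.mem_Icc.1 i.2
    have h' : (j : ℕ) = rowOf p i := congrArg Subtype.val h
    unfold rowOf at h'
    split_ifs at h' with h3
    · exact h1 ⟨h3, h'⟩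
    · exact h2 ⟨Subtype.ext h'.symm, by omega⟩

end Main

end

end Metacyclic

theorem mainTheorem8 (p : ℕ) [Fact p.Prime] (hp : p ≠ 2) (u : (ZMod p)ˣ)
    (hu : orderOf u = p - 1) :
    (∃ ι : Metacyclic.RowHat p 1 →ₗ[(Metacyclic.Lam p u)ᵐᵒᵖ] Metacyclic.yIdeal p u,
      Function.Injective ι ∧ Function.Exact ι (Metacyclic.yToAug p u)) ∧
    Function.Surjective (Metacyclic.yToAug p u) ∧
    ∀ (ι : Metacyclic.RowHat p 1 →ₗ[(Metacyclic.Lam p u)ᵐᵒᵖ] Metacyclic.yIdeal p u)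
      (hι : Function.Injective ι) (hex : Function.Exact ι (Metacyclic.yToAug p u))
      (ξ : Metacyclic.ExtOne p u),
      ∃! A : {A : Matrix (Metacyclic.Idx p) (Metacyclic.Idx p) ℤ // Metacyclic.IsSparse p A},
        ξ = Metacyclic.pushExt p u ι hι hex
          (Metacyclic.endOfMatrix p u A.1 A.2.isEndMatrix) := by
  refine ⟨Metacyclic.exists_iota p u hu, Metacyclic.yToAug_surjective p u, fun ι hι hex ξ => ?_⟩
  obtain ⟨φ, rfl⟩ := Metacyclic.exists_eq_pushExt p u ι hι hex hu ξ
  -- Push-out is additive in the endomorphism, so equality of two push-outs is a congruence modulo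
  -- `p` of diagonal scalars.
  have key : ∀ (A : Matrix (Metacyclic.Idx p) (Metacyclic.Idx p) ℤ)
      (hA : Metacyclic.IsEndMatrix p A),
      Metacyclic.pushExt p u ι hι hex φ =
        Metacyclic.pushExt p u ι hι hex (Metacyclic.endOfMatrix p u A hA) ↔
      ∀ i, (p : ℤ) ∣ Metacyclic.diagScalar p hp u φ i - A i (Metacyclic.rowIdx p hp i) := by
    intro A hA
    rw [← sub_eq_zero, ← Metacyclic.pushExt_sub,
      Metacyclic.pushExt_eq_zero_iff_dvd p hp u hu ι hι hex]
    simp only [Metacyclic.diagScalar_sub, Metacyclic.diagScalar_endOfMatrix]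
  refine ⟨⟨_, Metacyclic.isSparse_sparseMatrix p hp (Metacyclic.diagScalar p hp u φ)⟩,
    (key _ _).2 fun i => ?_, ?_⟩
  · simp only [Metacyclic.sparseMatrix, Matrix.of_apply, if_true]
    exact Int.dvd_self_sub_emod
  · rintro ⟨B, hB⟩ h
    apply Subtype.ext
    ext i j
    change B i j = Metacyclic.sparseMatrix p hp (Metacyclic.diagScalar p hp u φ) i j
    by_cases hij : j = Metacyclic.rowIdx p hp i
    · subst hij
      have h1 := (key _ _).1 h i
      simp only [Metacyclic.sparseMatrix, Matrix.of_apply, if_true]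
      have h2 := hB.nonneg i (Metacyclic.rowIdx p hp i)
      have h3 := hB.le i (Metacyclic.rowIdx p hp i)
      rw [← Int.emod_eq_of_lt h2 (show _ < (p : ℤ) by omega)]
      exact Int.modEq_iff_dvd.2 h1
    · rw [Metacyclic.IsSparse.apply_eq_zero p hp hB i j hij]
      simp only [Metacyclic.sparseMatrix, Matrix.of_apply, if_neg hij]
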